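/- Let $A,B$ be finite-dimensional quantum systems, i.e. $\mathbb C^{d_A},\mathbb C^{d_B}$ with fixed bases, let $T_B$ denote the partial transpose on $B$, and let $\langle X,Y\rangle=\operatorname{Tr}(X^\dagger Y)$, $\|X\|_1=\operatorname{Tr}|X|$, and $\|X\|_\infty$ the operator norm. The Rains set is $\mathcal R(A|B)=\{X\succeq 0 : \|X^{T_B}\|_1\le 1\}$, its polar is $\mathcal R^\circ=\{W \text{ Hermitian} : \langle W,X\rangle\le 1\ \forall X\in\mathcal R\}$, and $\Gamma_{\mathcal R^\circ}(W)=\inf\{\lambda\ge 0 : W\in\lambda\mathcal R^\circ\}$. A completely positive trace-preserving (CPTP) map $\Lambda:AB\to A'B'$ is Rains-preserving if $X\in\mathcal R(A|B)$ implies $\Lambda(X)\in\mathcal R(A'|B')$, and it is a PPT operation if $T_{B'}\circ\Lambda\circ T_B$ is completely positive. Let $\Psi_m=|\Psi_m\rangle\langle\Psi_m|$ with $|\Psi_m\rangle=\frac1{\sqrt m}\sum_{i=1}^m|ii\rangle$. For a class $\mathcal O$ of CPTP maps put $F_{\mathcal O}(\rho,m)=\sup_{\Lambda\in\mathcal O}\langle\Lambda(\rho),\Psi_m\rangle$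 (over $\Lambda\in\mathcal O$ with output system $m\times m$), $$E^{(1),\varepsilon}_{d,\mathcal O}(\rho)=\log_2\max\{m\ge 1: F_{\mathcal O}(\rho,m)\ge 1-\varepsilon\},\qquad E^{\infty,0}_{d,\mathcal O}(\rho)=\limsup_{n\to\infty}\frac1n E^{(1),0}_{d,\mathcal O}(\rho^{\otimes n}),$$ where $\rho^{\otimes n}$ is regarded as a state of the bipartite system $A^n|B^n$, and where $\log_2\max\varnothing=-\infty$. Let $\rho$ be a density matrix on $AB$ and let $\Pi_\rho$ be the orthogonal projector onto its support. Then $\Gamma_{\mathcal R^\circ}(\Pi_\rho)>0$ and: 1. the asymptotic zero-error distillable entanglement under the class $\mathrm{RP}$ of Rains-preserving operations is $$E^{\infty,0}_{d,\mathrm{RP}}(\rho)=-\log_2\Gamma_{\mathcal R^\circ}(\Pi_\rho);$$ 2. $\displaystyle \Gamma_{\mathcal R^\circ}(\Pi_\rho)=\min\{\|Q^{T_B}\|_\infty : Q\text{ Hermitian},\ Q\succeq\Pi_\rho\}$, the minimum being attained; 3. $\Gamma_{\mathcal R^\circ}(\Pi_\rho^{\otimes n})=\Gamma_{\mathcal R^\circ}(\Pi_\rho)^n$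 for every $n\in\mathbb N$, the left-hand side being taken with respect to the bipartition $A^n|B^n$; 4. consequently, $E^{\infty,0}_{d,\mathcal O}(\rho)\le-\log_2\Gamma_{\mathcal R^\circ}(\Pi_\rho)$ for every class $\mathcal O$ of PPT operations (a single-letter zero-error Rains bound). -/

import Mathlib

open scoped Matrix ComplexOrder

noncomputable section

namespace ZeroErrorRains

/-- Operators on the bipartite space `ℂ^A ⊗ ℂ^B`, as matrices in the product basis. -/
abbrev BMat (A B : Type*) := Matrix (A × B) (A × B) ℂ

/-- The Hilbert-Schmidt inner product `⟨X, Y⟩ = Tr (X† Y)`; its value is real on Hermitian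
matrices, which are the only ones it is used for. -/
def hsInner {α : Type*} [Fintype α] (X Y : Matrix α α ℂ) : ℝ :=
  ((Xᴴ * Y).trace).re

/-- Density matrices. -/
def IsState {α : Type*} [Fintype α] (ρ : Matrix α α ℂ) : Prop :=
  ρ.PosSemidef ∧ ρ.trace = 1

/-- The partial transpose `T_B` on the second subsystem, as a linear map. -/
def partialTranspose (A B : Type*) : BMat A B →ₗ[ℂ] BMat A B where
  toFun X := Matrix.of fun p q => X (p.1, q.2) (q.1, p.2)
  map_add' _ _ := rfl
  map_smul' _ _ := rfl

open scoped MatrixOrder in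
/-- The trace norm `‖X‖₁ = Tr |X|`, with `|X| = (X† X)^{1/2}`. -/
def traceNorm {α : Type*} [Fintype α] [DecidableEq α] (X : Matrix α α ℂ) : ℝ :=
  ((CFC.abs X).trace).re

/-- The operator norm `‖X‖_∞` of `X` acting on the Euclidean space `ℂ^α`. -/
def opNorm {α : Type*} [Fintype α] [DecidableEq α] (X : Matrix α α ℂ) : ℝ :=
  ‖Matrix.toEuclideanCLM (n := α) (𝕜 := ℂ) X‖

/-- The orthogonal projector onto the support (the range) of a Hermitian matrix `ρ`. -/
def supportProj {α : Type*} [Fintype α] [DecidableEq α] (ρ : Matrix α α ℂ) : Matrix α α ℂ :=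
  (Matrix.toEuclideanCLM (n := α) (𝕜 := ℂ)).symm
    (LinearMap.range (Matrix.toEuclideanCLM (n := α) (𝕜 := ℂ) ρ).toLinearMap).starProjection

/-- The tensor power `X^{⊗ n}`, regarded as an operator of the bipartite system with parts
`A^n` and `B^n`. -/
def tensorPow {A B : Type*} (X : BMat A B) (n : ℕ) : BMat (Fin n → A) (Fin n → B) :=
  Matrix.of fun p q => ∏ i, X (p.1 i, p.2 i) (q.1 i, q.2 i)

/-- The Rains set `{X ⪰ 0 | ‖X^{T_B}‖₁ ≤ 1}`. -/
def rainsSet (A B : Type*) [Fintype A] [Fintype B] [DecidableEq A] [DecidableEq B] :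
    Set (BMat A B) :=
  {X | X.PosSemidef ∧ traceNorm (partialTranspose A B X) ≤ 1}

/-- The polar `S° = {X | ⟨X, Y⟩ ≤ 1 for all Y ∈ S}` in the real space of Hermitian matrices. -/
def polar {α : Type*} [Fintype α] (S : Set (Matrix α α ℂ)) : Set (Matrix α α ℂ) :=
  {X | X.IsHermitian ∧ ∀ Y ∈ S, hsInner X Y ≤ 1}

/-- The gauge function of the polar of the Rains set. -/
def gammaRains {A B : Type*} [Fintype A] [Fintype B] [DecidableEq A] [DecidableEq B]
    (W : BMat A B) : ℝ :=
  gauge (polar (rainsSet A B)) W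

/-- The map `id_κ ⊗ Λ`. -/
def ampliation (κ : Type*) {α β : Type*} (Λ : Matrix α α ℂ →ₗ[ℂ] Matrix β β ℂ)
    (X : Matrix (κ × α) (κ × α) ℂ) : Matrix (κ × β) (κ × β) ℂ :=
  Matrix.of fun p q => Λ (Matrix.of fun a a' => X (p.1, a) (q.1, a')) p.2 q.2

/-- Complete positivity: `id_k ⊗ Λ` preserves positive semidefiniteness for every `k`. -/
def IsCP {α β : Type*} (Λ : Matrix α α ℂ →ₗ[ℂ] Matrix β β ℂ) : Prop :=
  ∀ (k : ℕ) (X : Matrix (Fin k × α) (Fin k × α) ℂ),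
    X.PosSemidef → (ampliation (Fin k) Λ X).PosSemidef

/-- Completely positive trace-preserving maps. -/
def IsCPTP {α β : Type*} [Fintype α] [Fintype β]
    (Λ : Matrix α α ℂ →ₗ[ℂ] Matrix β β ℂ) : Prop :=
  IsCP Λ ∧ ∀ X, (Λ X).trace = X.trace

/-- Rains-preserving operations `AB → A'B'`: channels mapping the Rains set to the Rains set. -/
def rainsPreserving (A B A' B' : Type*) [Fintype A] [Fintype B] [Fintype A'] [Fintype B']
    [DecidableEq A] [DecidableEq B] [DecidableEq A'] [DecidableEq B'] :
    Set (BMat A B →ₗ[ℂ] BMat A' B') :=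
  {Λ | IsCPTP Λ ∧ ∀ X ∈ rainsSet A B, Λ X ∈ rainsSet A' B'}

/-- PPT operations `AB → A'B'`: channels `Λ` such that `T_{B'} ∘ Λ ∘ T_B` is completely
positive. -/
def pptOperations (A B A' B' : Type*) [Fintype A] [Fintype B] [Fintype A'] [Fintype B'] :
    Set (BMat A B →ₗ[ℂ] BMat A' B') :=
  {Λ | IsCPTP Λ ∧ IsCP (partialTranspose A' B' ∘ₗ Λ ∘ₗ partialTranspose A B)}

/-- The vector `∑ i, |ii⟩ / √m`. -/
def maxEntVec (m : ℕ) : Fin m × Fin m → ℂ :=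
  fun p => if p.1 = p.2 then (((1 / Real.sqrt m : ℝ)) : ℂ) else 0

/-- The maximally entangled state `Ψ_m`. -/
def maxEnt (m : ℕ) : BMat (Fin m) (Fin m) :=
  Matrix.vecMulVec (maxEntVec m) (star (maxEntVec m))

/-- The fidelity of distillation `sup_{Λ ∈ 𝒪} ⟨Λ(ρ), Ψ_m⟩`. -/
def fidelity {A B : Type*} {m : ℕ} (𝒪 : Set (BMat A B →ₗ[ℂ] BMat (Fin m) (Fin m)))
    (ρ : BMat A B) : ℝ :=
  sSup ((fun Λ => hsInner (Λ ρ) (maxEnt m)) '' 𝒪)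

/-- The one-shot `ε`-error distillable entanglement
`log max {m ≥ 1 | F(ρ, m) ≥ 1 - ε}` (base 2), written as the supremum of `log m` in the extended
reals. The set `𝒪 m` consists of the allowed operations with output system `m × m`. -/
def oneShotDistillable {A B : Type*}
    (𝒪 : ∀ m : ℕ, Set (BMat A B →ₗ[ℂ] BMat (Fin m) (Fin m))) (ε : ℝ) (ρ : BMat A B) : EReal :=
  ⨆ m ∈ {m : ℕ | 1 ≤ m ∧ 1 - ε ≤ fidelity (𝒪 m) ρ}, ((Real.logb 2 m : ℝ) : EReal)

/-- The asymptotic zero-error distillable entanglement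
`limsup_n (1/n) E^{(1),0}(ρ^{⊗ n})`. The set `𝒪 n m` consists of the allowed operations with
input system `A^n B^n` and output system `m × m`. -/
def asymptoticZeroError {A B : Type*}
    (𝒪 : ∀ n m : ℕ, Set (BMat (Fin n → A) (Fin n → B) →ₗ[ℂ] BMat (Fin m) (Fin m)))
    (ρ : BMat A B) : EReal :=
  Filter.limsup
    (fun n : ℕ => ((1 / (n : ℝ) : ℝ) : EReal) * oneShotDistillable (𝒪 n) 0 (tensorPow ρ n))
    Filter.atTop

end ZeroErrorRains

end

/-! On Hermitian `W` the gauge of the polar of the Rains set is the support function `sup ⟨W, Y⟩`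
over the set (`gammaRains_le_iff`). Hahn–Banach separation gives the dual form, with an attaining
`Q` (`exists_opNorm_partialTranspose_le`, `isLeast_gammaRains`). The supremum is
supermultiplicative, by tensoring feasible `Y`, and the minimum is submultiplicative, by tensoring
feasible `Q`; hence `gammaRains_tensorPow`.

The operational link is `one_le_fidelity_iff`: `Ψ_m` is distilled perfectly iff `Γ(Π_ρ) ≤ 1 / m`. If
`Λ` succeeds with certainty, the effect `E = Λ†(Ψ_m)` dominates `Π_ρ`, while `⟨E, Y⟩ ≤ 1 / m` on the
Rains set because `Ψ_m` has overlap at most `1 / m` with it. Conversely, measure `{Π_ρ, 1 - Π_ρ}`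
and prepare `Ψ_m` or an isotropic state.

So the one-shot rate is `log ⌊1 / Γ⌋`, within one bit of `-log Γ`. On `ρ^{⊗ n}` the latter is
exactly `n` times its one-copy value, and the rounding loss vanishes after division by `n`. The PPT
bound follows because PPT operations preserve the Rains set. -/

noncomputable section

namespace ZeroErrorRains

section MatrixOrder

open scoped MatrixOrder

/-! ### Positive semidefinite matrices and the Hilbert–Schmidt pairing. -/

section Basic

variable {α : Type*}

theorem posSemidef_real_smul {M : Matrix α α ℂ} (hM : M.PosSemidef) {c : ℝ} (hc : 0 ≤ c) :
    (c • M).PosSemidef :=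
  hM.smul hc

theorem isHermitian_real_smul {M : Matrix α α ℂ} (hM : M.IsHermitian) (c : ℝ) :
    (c • M).IsHermitian := by
  rw [Matrix.IsHermitian, Matrix.conjTranspose_smul, hM.eq, star_trivial]

variable [Fintype α]

theorem exists_eq_conjTranspose_mul_self {M : Matrix α α ℂ} (hM : M.PosSemidef) :
    ∃ C : Matrix α α ℂ, M = Cᴴ * C := by
  classical
  exact CStarAlgebra.nonneg_iff_eq_star_mul_self.mp hM.nonneg

theorem posSemidef_of_isHermitian_of_mul_self {P : Matrix α α ℂ} (hP : P.IsHermitian)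
    (hPP : P * P = P) : P.PosSemidef := by
  have h := Matrix.posSemidef_conjTranspose_mul_self P
  rwa [hP.eq, hPP] at h

theorem posSemidef_one_sub_of_mul_self [DecidableEq α] {P : Matrix α α ℂ} (hP : P.IsHermitian)
    (hPP : P * P = P) : (1 - P).PosSemidef :=
  posSemidef_of_isHermitian_of_mul_self (Matrix.isHermitian_one.sub hP) (by
    rw [sub_mul, mul_sub, mul_sub, hPP]; simp)

theorem hsInner_add_left (X Y Z : Matrix α α ℂ) :
    hsInner (X + Y) Z = hsInner X Z + hsInner Y Z := by
  simp [hsInner, add_mul]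

theorem hsInner_sub_left (X Y Z : Matrix α α ℂ) :
    hsInner (X - Y) Z = hsInner X Z - hsInner Y Z := by
  simp [hsInner, sub_mul]

theorem hsInner_sub_right (X Y Z : Matrix α α ℂ) :
    hsInner X (Y - Z) = hsInner X Y - hsInner X Z := by
  simp [hsInner, mul_sub]

theorem hsInner_add_right (X Y Z : Matrix α α ℂ) :
    hsInner X (Y + Z) = hsInner X Y + hsInner X Z := by
  simp [hsInner, mul_add]

theorem hsInner_smul_left (c : ℝ) (X Y : Matrix α α ℂ) :
    hsInner (c • X) Y = c * hsInner X Y := by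
  simp [hsInner]

theorem hsInner_smul_right (c : ℝ) (X Y : Matrix α α ℂ) :
    hsInner X (c • Y) = c * hsInner X Y := by
  simp [hsInner]

theorem hsInner_comm (X Y : Matrix α α ℂ) : hsInner X Y = hsInner Y X := by
  have h : Xᴴ * Y = (Yᴴ * X)ᴴ := by simp
  rw [hsInner, h, Matrix.trace_conjTranspose]
  simp [hsInner]

theorem hsInner_one_left [DecidableEq α] (X : Matrix α α ℂ) : hsInner 1 X = X.trace.re := by
  simp [hsInner]

theorem continuous_hsInner_right (X : Matrix α α ℂ) : Continuous (hsInner X) := by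
  unfold hsInner
  fun_prop

theorem trace_conjTranspose_mul_nonneg {X Y : Matrix α α ℂ} (hX : X.PosSemidef)
    (hY : Y.PosSemidef) : 0 ≤ (Xᴴ * Y).trace := by
  obtain ⟨C, rfl⟩ := exists_eq_conjTranspose_mul_self hX
  have h : ((Cᴴ * C)ᴴ * Y).trace = (C * Y * Cᴴ).trace := by
    rw [Matrix.conjTranspose_mul, Matrix.conjTranspose_conjTranspose, Matrix.mul_assoc,
      Matrix.trace_mul_comm]
  rw [h]
  exact (hY.mul_mul_conjTranspose_same C).trace_nonneg

theorem hsInner_nonneg {X Y : Matrix α α ℂ} (hX : X.PosSemidef) (hY : Y.PosSemidef) :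
    0 ≤ hsInner X Y :=
  (Complex.nonneg_iff.mp (trace_conjTranspose_mul_nonneg hX hY)).1

theorem hsInner_mono_left {X X' Y : Matrix α α ℂ} (h : (X' - X).PosSemidef)
    (hY : Y.PosSemidef) : hsInner X Y ≤ hsInner X' Y := by
  have := hsInner_nonneg h hY
  rw [hsInner_sub_left] at this
  linarith

/-- With `X = C†C` and `Y = D†D`, the pairing is the squared Hilbert–Schmidt norm of `C D†`. -/
theorem mul_eq_zero_of_hsInner_eq_zero {X Y : Matrix α α ℂ} (hX : X.PosSemidef)
    (hY : Y.PosSemidef) (h : hsInner X Y = 0) : X * Y = 0 := by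
  have h0 : (Xᴴ * Y).trace = 0 := by
    have h1 := Complex.nonneg_iff.mp (trace_conjTranspose_mul_nonneg hX hY)
    exact Complex.ext h h1.2.symm
  rw [hX.isHermitian.eq] at h0
  obtain ⟨C, rfl⟩ := exists_eq_conjTranspose_mul_self hX
  obtain ⟨D, rfl⟩ := exists_eq_conjTranspose_mul_self hY
  have h2 : (Cᴴ * C * (Dᴴ * D)).trace = ((C * Dᴴ)ᴴ * (C * Dᴴ)).trace := by
    rw [Matrix.conjTranspose_mul, Matrix.conjTranspose_conjTranspose,
      ← Matrix.mul_assoc, Matrix.trace_mul_comm]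
    simp only [Matrix.mul_assoc]
  rw [h2, Matrix.trace_conjTranspose_mul_self_eq_zero_iff] at h0
  calc Cᴴ * C * (Dᴴ * D) = Cᴴ * (C * Dᴴ) * D := by simp only [Matrix.mul_assoc]
    _ = 0 := by rw [h0]; simp

theorem star_dotProduct_self (v : α → ℂ) :
    star v ⬝ᵥ v = ((‖WithLp.toLp 2 v‖ ^ 2 : ℝ) : ℂ) := by
  have h := inner_self_eq_norm_sq_to_K (𝕜 := ℂ) (WithLp.toLp 2 v : EuclideanSpace ℂ α)
  rw [EuclideanSpace.inner_eq_star_dotProduct] at h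
  rw [dotProduct_comm]
  simpa using h

end Basic

/-! ### Operator norm, trace norm and their duality. -/

section Norms

variable {α : Type*} [Fintype α] [DecidableEq α]

/-- A norm bound becomes a semidefinite inequality, which is visibly closed and behaves well under
tensor powers. -/
theorem opNorm_le_iff {Y : Matrix α α ℂ} {c : ℝ} (hc : 0 ≤ c) :
    opNorm Y ≤ c ↔ ((c ^ 2) • (1 : Matrix α α ℂ) - Yᴴ * Y).PosSemidef := by
  have key : ∀ v : α → ℂ, star v ⬝ᵥ ((c ^ 2) • (1 : Matrix α α ℂ) - Yᴴ * Y) *ᵥ v =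
      (((c * ‖WithLp.toLp 2 v‖) ^ 2 - ‖WithLp.toLp 2 (Y *ᵥ v)‖ ^ 2 : ℝ) : ℂ) := by
    intro v
    rw [Matrix.sub_mulVec, dotProduct_sub, ← Matrix.mulVec_mulVec, Matrix.dotProduct_mulVec,
      Matrix.dotProduct_mulVec (star v) Yᴴ, Matrix.vecMul_conjTranspose, star_star,
      star_dotProduct_self, Matrix.vecMul_smul, Matrix.vecMul_one, smul_dotProduct,
      star_dotProduct_self]
    push_cast
    rw [Complex.real_smul]
    push_cast
    ring
  have hH : ((c ^ 2) • (1 : Matrix α α ℂ) - Yᴴ * Y).IsHermitian :=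
    (isHermitian_real_smul Matrix.isHermitian_one _).sub
      (Matrix.isHermitian_conjTranspose_mul_self Y)
  rw [opNorm, ContinuousLinearMap.opNorm_le_iff hc, Matrix.posSemidef_iff_dotProduct_mulVec]
  constructor
  · refine fun h => ⟨hH, fun v => ?_⟩
    rw [key, Complex.zero_le_real, sub_nonneg]
    exact pow_le_pow_left₀ (norm_nonneg _) (h (WithLp.toLp 2 v)) 2
  · rintro ⟨-, h⟩ x
    have h1 := h x.ofLp
    rw [key, Complex.zero_le_real, sub_nonneg] at h1
    exact (pow_le_pow_iff_left₀ (norm_nonneg _) (by positivity) two_ne_zero).mp h1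

theorem opNorm_nonneg (Y : Matrix α α ℂ) : 0 ≤ opNorm Y := norm_nonneg _

theorem opNorm_smul (c : ℝ) (Y : Matrix α α ℂ) : opNorm (c • Y) = |c| * opNorm Y := by
  have h : c • Y = (c : ℂ) • Y := by ext; simp
  rw [opNorm, h, map_smul, norm_smul]
  simp [opNorm]

theorem opNorm_neg (Y : Matrix α α ℂ) : opNorm (-Y) = opNorm Y := by
  simp [opNorm]

theorem opNorm_add_le (X Y : Matrix α α ℂ) : opNorm (X + Y) ≤ opNorm X + opNorm Y := by
  simpa [opNorm] using norm_add_le _ _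

theorem eq_zero_of_opNorm_le_zero {Y : Matrix α α ℂ} (h : opNorm Y ≤ 0) : Y = 0 := by
  have h1 := norm_le_zero_iff.mp h
  exact (map_eq_zero_iff _ (Matrix.toEuclideanCLM (n := α) (𝕜 := ℂ)).injective).mp h1

theorem opNorm_one_le : opNorm (1 : Matrix α α ℂ) ≤ 1 := by
  rw [opNorm_le_iff zero_le_one]
  simpa using Matrix.PosSemidef.zero

theorem posSemidef_smul_one_sub {Y : Matrix α α ℂ} (hY : Y.IsHermitian) {c : ℝ}
    (h : opNorm Y ≤ c) : (c • (1 : Matrix α α ℂ) - Y).PosSemidef := by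
  have hc : 0 ≤ c := (opNorm_nonneg Y).trans h
  have hH : (c • (1 : Matrix α α ℂ) - Y).IsHermitian :=
    (isHermitian_real_smul Matrix.isHermitian_one _).sub hY
  refine Matrix.PosSemidef.of_dotProduct_mulVec_nonneg hH fun v => ?_
  have him : (star v ⬝ᵥ (c • (1 : Matrix α α ℂ) - Y) *ᵥ v).im = 0 :=
    hH.im_star_dotProduct_mulVec_self v
  refine Complex.nonneg_iff.mpr ⟨?_, him.symm⟩
  rw [Matrix.sub_mulVec, dotProduct_sub, Matrix.smul_mulVec, Matrix.one_mulVec, dotProduct_smul,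
    star_dotProduct_self, Complex.sub_re, sub_nonneg]
  have h1 : star v ⬝ᵥ Y *ᵥ v =
      inner ℂ (WithLp.toLp 2 v) (Matrix.toEuclideanCLM (n := α) (𝕜 := ℂ) Y (WithLp.toLp 2 v)) := by
    rw [EuclideanSpace.inner_eq_star_dotProduct, dotProduct_comm]
    rfl
  rw [h1]
  calc _ ≤ ‖_‖ := Complex.re_le_norm _
    _ ≤ _ := norm_inner_le_norm _ _
    _ ≤ ‖WithLp.toLp 2 v‖ * (c * ‖WithLp.toLp 2 v‖) := by
      gcongr
      exact ContinuousLinearMap.le_of_opNorm_le _ h _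
    _ = _ := by
      simp [-Complex.ofReal_pow]
      ring

theorem hsInner_le_mul_trace {U P : Matrix α α ℂ} (hU : U.IsHermitian) {c : ℝ}
    (h : opNorm U ≤ c) (hP : P.PosSemidef) : hsInner U P ≤ c * P.trace.re := by
  have := hsInner_mono_left (posSemidef_smul_one_sub hU h) hP
  rwa [hsInner_smul_left, hsInner_one_left] at this

/-- The Jordan decomposition of a Hermitian matrix, with the sign attaining the trace norm. -/
theorem exists_jordan {Y : Matrix α α ℂ} (hY : Y.IsHermitian) :
    ∃ P N U : Matrix α α ℂ, P.PosSemidef ∧ N.PosSemidef ∧ Y = P - N ∧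
      traceNorm Y = P.trace.re + N.trace.re ∧ U.IsHermitian ∧ opNorm U ≤ 1 ∧
      hsInner U Y = traceNorm Y := by
  have hS : IsSelfAdjoint Y := hY
  -- The spectrum is finite, so even the discontinuous sign function is admissible in the functional
  -- calculus.
  have hcont : ∀ f : ℝ → ℝ, ContinuousOn f (spectrum ℝ Y) := fun f =>
    Matrix.finite_real_spectrum.continuousOn f
  have habs : CFC.abs Y = cfc (fun x : ℝ => ‖x‖) Y := CFC.abs_eq_cfc_norm Y hS
  refine ⟨cfc (fun x : ℝ => max x 0) Y, cfc (fun x : ℝ => max (-x) 0) Y,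
    cfc (fun x : ℝ => if 0 ≤ x then 1 else -1) Y, ?_, ?_, ?_, ?_, ?_, ?_, ?_⟩
  · exact Matrix.nonneg_iff_posSemidef.mp (cfc_nonneg fun x _ => le_max_right _ _)
  · exact Matrix.nonneg_iff_posSemidef.mp (cfc_nonneg fun x _ => le_max_right _ _)
  · rw [← cfc_sub _ _ Y (hcont _) (hcont _)]
    conv_lhs => rw [← cfc_id' ℝ Y hS]
    refine cfc_congr fun x _ => ?_
    rcases le_total x 0 with h | h
    · simp [h]
    · simp [h]
  · rw [← Complex.add_re, ← Matrix.trace_add, ← cfc_add Y _ _ (hcont _) (hcont _), traceNorm, habs]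
    congr 3
    funext x
    rcases le_total x 0 with h | h
    · simp [h, abs_of_nonpos h]
    · simp [h, abs_of_nonneg h]
  · exact cfc_predicate _ Y
  · have hU : (cfc (fun x : ℝ => if 0 ≤ x then 1 else -1) Y)ᴴ =
        cfc (fun x : ℝ => if 0 ≤ x then 1 else -1) Y :=
      (cfc_predicate (p := IsSelfAdjoint) (fun x : ℝ => if 0 ≤ x then 1 else -1) Y)
    rw [opNorm_le_iff zero_le_one, hU, ← cfc_mul _ _ Y (hcont _) (hcont _)]
    have : cfc (fun x : ℝ => (if 0 ≤ x then 1 else -1) * (if 0 ≤ x then 1 else -1)) Y = 1 := by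
      rw [← cfc_const_one ℝ Y]
      refine cfc_congr fun x _ => ?_
      split_ifs <;> norm_num
    rw [this]
    simpa using Matrix.PosSemidef.zero
  · have hU : (cfc (fun x : ℝ => if 0 ≤ x then 1 else -1) Y)ᴴ =
        cfc (fun x : ℝ => if 0 ≤ x then 1 else -1) Y :=
      (cfc_predicate (p := IsSelfAdjoint) (fun x : ℝ => if 0 ≤ x then 1 else -1) Y)
    rw [hsInner, hU, traceNorm, habs]
    conv_lhs => 
      enter [1, 1, 2]
      rw [← cfc_id' ℝ Y hS]
    rw [← cfc_mul _ _ Y (hcont _) (hcont _)]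
    congr 3
    funext x
    split_ifs with h
    · simp [abs_of_nonneg h]
    · simp [abs_of_neg (not_le.mp h)]

/-- The matrix Hölder inequality for Hermitian matrices. -/
theorem hsInner_le_opNorm_mul_traceNorm {U Y : Matrix α α ℂ} (hU : U.IsHermitian)
    (hY : Y.IsHermitian) : hsInner U Y ≤ opNorm U * traceNorm Y := by
  obtain ⟨P, N, -, hP, hN, h1, h2, -⟩ := exists_jordan hY
  rw [h2]
  conv_lhs => rw [h1]
  rw [hsInner_sub_right]
  have h3 := hsInner_le_mul_trace hU le_rfl hP
  have h4 := hsInner_le_mul_trace (c := opNorm U) hU.neg (opNorm_neg U).le hN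
  have h5 : hsInner (-U) N = - hsInner U N := by simp [hsInner]
  rw [h5] at h4
  linarith

theorem traceNorm_nonneg {Y : Matrix α α ℂ} (hY : Y.IsHermitian) : 0 ≤ traceNorm Y := by
  obtain ⟨P, N, -, hP, hN, h1, h2, -⟩ := exists_jordan hY
  rw [h2]
  exact add_nonneg (Complex.nonneg_iff.mp hP.trace_nonneg).1
    (Complex.nonneg_iff.mp hN.trace_nonneg).1

/-- Testing `P - N` against its own sign needs no orthogonality of `P` and `N`. -/
theorem traceNorm_sub_le {P N : Matrix α α ℂ} (hP : P.PosSemidef) (hN : N.PosSemidef) :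
    traceNorm (P - N) ≤ P.trace.re + N.trace.re := by
  obtain ⟨-, -, U, -, -, -, -, hU, hU1, h⟩ := exists_jordan (hP.isHermitian.sub hN.isHermitian)
  rw [← h, hsInner_sub_right]
  have h3 := hsInner_le_mul_trace hU hU1 hP
  have h4 := hsInner_le_mul_trace hU.neg ((opNorm_neg U).le.trans hU1) hN
  have h5 : hsInner (-U) N = - hsInner U N := by simp [hsInner]
  rw [h5] at h4
  linarith

theorem traceNorm_le_of_posSemidef {P : Matrix α α ℂ} (hP : P.PosSemidef) :
    traceNorm P ≤ P.trace.re := by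
  simpa using traceNorm_sub_le hP Matrix.PosSemidef.zero

theorem traceNorm_smul {c : ℝ} (hc : 0 ≤ c) {Y : Matrix α α ℂ} (hY : Y.IsHermitian) :
    traceNorm (c • Y) ≤ c * traceNorm Y := by
  obtain ⟨P, N, -, hP, hN, h1, h2, -⟩ := exists_jordan hY
  rw [h2]
  conv_lhs => rw [h1, smul_sub]
  refine (traceNorm_sub_le (posSemidef_real_smul hP hc) (posSemidef_real_smul hN hc)).trans ?_
  simp [mul_add]

end Norms

end MatrixOrder

/-! ### Partial transposition as a self-inverse isometry. -/

section PartialTranspose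

variable {A B : Type*}

theorem partialTranspose_apply (X : BMat A B) (p q : A × B) :
    partialTranspose A B X p q = X (p.1, q.2) (q.1, p.2) := rfl

@[simp] theorem partialTranspose_partialTranspose (X : BMat A B) :
    partialTranspose A B (partialTranspose A B X) = X := rfl

theorem partialTranspose_real_smul (c : ℝ) (X : BMat A B) :
    partialTranspose A B (c • X) = c • partialTranspose A B X := rfl

theorem isHermitian_partialTranspose {X : BMat A B} (hX : X.IsHermitian) :
    (partialTranspose A B X).IsHermitian := by
  ext p q
  exact congrFun (congrFun hX (p.1, q.2)) (q.1, p.2)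

theorem partialTranspose_one [DecidableEq A] [DecidableEq B] :
    partialTranspose A B 1 = 1 := by
  ext p q
  simp only [partialTranspose_apply, Matrix.one_apply, Prod.ext_iff, eq_comm]

variable [Fintype A] [Fintype B]

theorem trace_partialTranspose (X : BMat A B) : (partialTranspose A B X).trace = X.trace := rfl

theorem hsInner_partialTranspose (X Y : BMat A B) :
    hsInner (partialTranspose A B X) (partialTranspose A B Y) = hsInner X Y := by
  simp only [hsInner, Matrix.trace, Matrix.diag, Matrix.mul_apply, Matrix.conjTranspose_apply,
    partialTranspose_apply, Fintype.sum_prod_type]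
  congr 1
  rw [Finset.sum_congr rfl fun a _ => Finset.sum_comm]
  conv_rhs => rw [Finset.sum_congr rfl fun a _ => Finset.sum_comm]
  refine Finset.sum_congr rfl fun a _ => Finset.sum_congr rfl fun a' _ => ?_
  exact Finset.sum_comm

end PartialTranspose

/-! ### Convex duality for the Rains set. -/

section Duality

theorem isClosed_posSemidef (α : Type*) [Fintype α] :
    IsClosed {M : Matrix α α ℂ | M.PosSemidef} := by
  simp only [Matrix.posSemidef_iff_dotProduct_mulVec, Set.ofPred_and, Set.ofPred_forall]
  refine IsClosed.inter (isClosed_eq (by fun_prop) continuous_id) (isClosed_iInter fun x => ?_)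
  exact isClosed_le continuous_const (by fun_prop)

theorem norm_apply_le_opNorm {α : Type*} [Fintype α] [DecidableEq α] (M : Matrix α α ℂ)
    (i j : α) : ‖M i j‖ ≤ opNorm M := by
  have h := (Matrix.toEuclideanCLM (n := α) (𝕜 := ℂ) M).le_opNorm (EuclideanSpace.single j 1)
  rw [PiLp.norm_single, norm_one, mul_one] at h
  refine le_trans ?_ h
  have h2 := PiLp.norm_apply_le
    (Matrix.toEuclideanCLM (n := α) (𝕜 := ℂ) M (EuclideanSpace.single j 1)) i
  simpa using h2

theorem isCompact_entrywise_le (α : Type*) (c : ℝ) :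
    IsCompact {M : Matrix α α ℂ | ∀ i j, ‖M i j‖ ≤ c} := by
  have h : IsCompact {M : α → α → ℂ | ∀ i j, ‖M i j‖ ≤ c} := by
    convert isCompact_univ_pi fun _ : α => isCompact_univ_pi fun _ : α =>
      isCompact_closedBall (0 : ℂ) c using 1
    ext M
    simp
  exact h

theorem exists_hsInner_eq {α : Type*} [Fintype α] (f : Matrix α α ℂ →ₗ[ℝ] ℝ) :
    ∃ X : Matrix α α ℂ, X.IsHermitian ∧ ∀ M : Matrix α α ℂ, M.IsHermitian → f M = hsInner X M := by
  classical
  -- The values of `f` on `E_ij` and `i E_ij` are the real and imaginary parts of the entry. Passing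
  -- to the Hermitian part of `Z` below leaves the pairing with Hermitian matrices unchanged.
  let Z : Matrix α α ℂ := Matrix.of fun i j =>
    (f (Matrix.single i j 1) : ℂ) + f (Matrix.single i j Complex.I) * Complex.I
  have hZ : ∀ M, f M = hsInner Z M := by
    intro M
    have h1 : ∀ i j, Matrix.single i j (M i j) =
        (M i j).re • Matrix.single i j (1 : ℂ) + (M i j).im • Matrix.single i j Complex.I := by
      intro i j
      rw [Matrix.smul_single, Matrix.smul_single, ← Matrix.single_add]
      congr 1
      simp
    conv_lhs => rw [Matrix.matrix_eq_sum_single M]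
    simp only [map_sum, h1, map_add, map_smul, hsInner, Matrix.trace, Matrix.diag,
      Matrix.mul_apply, Matrix.conjTranspose_apply, Complex.re_sum]
    rw [Finset.sum_comm]
    refine Finset.sum_congr rfl fun i _ => Finset.sum_congr rfl fun j _ => ?_
    simp [Z]
    ring
  refine ⟨(1 / 2 : ℝ) • (Z + Zᴴ), isHermitian_real_smul (Matrix.isHermitian_add_transpose_self Z) _,
    fun M hM => ?_⟩
  have h2 : hsInner Zᴴ M = hsInner Z M := by
    rw [hsInner, Matrix.conjTranspose_conjTranspose, Matrix.trace_mul_comm, hsInner_comm, hsInner,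
      hM.eq]
  rw [hsInner_smul_left, hsInner_add_left, h2, hZ]
  ring

theorem posSemidef_of_hsInner_nonneg {α : Type*} [Fintype α] {X : Matrix α α ℂ}
    (hX : X.IsHermitian) (h : ∀ P : Matrix α α ℂ, P.PosSemidef → 0 ≤ hsInner X P) :
    X.PosSemidef := by
  refine Matrix.PosSemidef.of_dotProduct_mulVec_nonneg hX fun w => ?_
  refine Complex.nonneg_iff.mpr ⟨?_, (hX.im_star_dotProduct_mulVec_self w).symm⟩
  have h1 := h _ (Matrix.posSemidef_vecMulVec_self_star w)
  rw [hsInner, hX.eq, Matrix.mul_vecMulVec, Matrix.trace_vecMulVec, dotProduct_comm] at h1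
  exact h1

variable {A B : Type*} [Fintype A] [Fintype B] [DecidableEq A] [DecidableEq B]

theorem zero_mem_rainsSet : (0 : BMat A B) ∈ rainsSet A B := by
  refine ⟨Matrix.PosSemidef.zero, ?_⟩
  rw [map_zero]
  exact (traceNorm_le_of_posSemidef Matrix.PosSemidef.zero).trans (by simp)

theorem smul_mem_rainsSet {X : BMat A B} (hX : X.PosSemidef) {c : ℝ} (hc : 0 ≤ c)
    (h : c * traceNorm (partialTranspose A B X) ≤ 1) : c • X ∈ rainsSet A B := by
  refine ⟨posSemidef_real_smul hX hc, ?_⟩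
  rw [partialTranspose_real_smul]
  exact (traceNorm_smul hc (isHermitian_partialTranspose hX.isHermitian)).trans h

theorem hsInner_le_opNorm_partialTranspose {Q W Y : BMat A B} (hQ : Q.IsHermitian)
    (hQW : (Q - W).PosSemidef) (hY : Y ∈ rainsSet A B) :
    hsInner W Y ≤ opNorm (partialTranspose A B Q) := by
  refine (hsInner_mono_left hQW hY.1).trans ?_
  rw [← hsInner_partialTranspose]
  refine (hsInner_le_opNorm_mul_traceNorm (isHermitian_partialTranspose hQ)
    (isHermitian_partialTranspose hY.1.isHermitian)).trans ?_
  exact mul_le_of_le_one_right (opNorm_nonneg _) hY.2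

/-- Strong duality for the support function of the Rains set. -/
theorem exists_opNorm_partialTranspose_le {W : BMat A B} (hW : W.IsHermitian) {c : ℝ} (hc : 0 ≤ c)
    (h : ∀ Y ∈ rainsSet A B, hsInner W Y ≤ c) :
    ∃ Q : BMat A B, Q.IsHermitian ∧ (Q - W).PosSemidef ∧
      opNorm (partialTranspose A B Q) ≤ c := by
  -- Infeasibility means that the compact norm ball `s` misses the closed shifted cone `t = W +
  -- PSD`. The separating functional will yield a point of the Rains set violating `h`.
  by_contra! hcon
  set s : Set (BMat A B) := {Q | Q.IsHermitian ∧ opNorm (partialTranspose A B Q) ≤ c} with hs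
  set t : Set (BMat A B) := {Q | (Q - W).PosSemidef} with ht
  have hsconv : Convex ℝ s := by
    intro X hX Y hY a b ha hb hab
    refine ⟨(isHermitian_real_smul hX.1 a).add (isHermitian_real_smul hY.1 b), ?_⟩
    rw [map_add, partialTranspose_real_smul, partialTranspose_real_smul]
    refine (opNorm_add_le _ _).trans ?_
    rw [opNorm_smul, opNorm_smul, abs_of_nonneg ha, abs_of_nonneg hb]
    calc _ ≤ a * c + b * c := by gcongr; exacts [hX.2, hY.2]
      _ = c := by rw [← add_mul, hab, one_mul]
  have htconv : Convex ℝ t := by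
    intro X hX Y hY a b ha hb hab
    have h1 : a • X + b • Y - W = a • (X - W) + b • (Y - W) := by
      have : W = a • W + b • W := by rw [← add_smul, hab, one_smul]
      conv_lhs => rw [this]
      module
    change (a • X + b • Y - W).PosSemidef
    rw [h1]
    exact (posSemidef_real_smul hX ha).add (posSemidef_real_smul hY hb)
  have htclosed : IsClosed t :=
    (isClosed_posSemidef (A × B)).preimage (continuous_id.sub continuous_const)
  have hsclosed : IsClosed s := by
    have : s = {Q : BMat A B | Qᴴ = Q} ∩ {Q | ((c ^ 2) • (1 : BMat A B) -
        (partialTranspose A B Q)ᴴ * partialTranspose A B Q).PosSemidef} := by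
      ext Q
      simp only [hs, opNorm_le_iff hc]
      rfl
    rw [this]
    have hT : Continuous (partialTranspose A B) :=
      (continuous_matrix fun p q => continuous_id.matrix_elem _ _)
    refine IsClosed.inter (isClosed_eq (by fun_prop) continuous_id) ?_
    exact (isClosed_posSemidef (A × B)).preimage (by fun_prop)
  have hscompact : IsCompact s := by
    refine (isCompact_entrywise_le (A × B) c).of_isClosed_subset hsclosed ?_
    intro Q hQ p q
    exact (norm_apply_le_opNorm (partialTranspose A B Q) (p.1, q.2) (q.1, p.2)).trans hQ.2
  have hdisj : Disjoint s t := by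
    rw [Set.disjoint_left]
    exact fun Q hQ hQt => (hcon Q hQ.1 hQt).not_ge hQ.2
  have : LocallyConvexSpace ℝ (BMat A B) :=
    inferInstanceAs (LocallyConvexSpace ℝ (A × B → A × B → ℂ))
  obtain ⟨f, u, v, hfs, huv, hft⟩ :=
    geometric_hahn_banach_compact_closed hsconv hscompact htconv htclosed hdisj
  obtain ⟨X, hX, hfX⟩ := exists_hsInner_eq f.toLinearMap
  replace hfX : ∀ M : BMat A B, M.IsHermitian → f M = hsInner X M := hfX
  have hsep : ∀ Q ∈ s, ∀ P : BMat A B, P.PosSemidef →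
      hsInner X Q < hsInner X W + hsInner X P := by
    intro Q hQ P hP
    rw [← hsInner_add_right, ← hfX Q hQ.1, ← hfX _ (hW.add hP.isHermitian)]
    refine (hfs Q hQ).trans (huv.trans (hft _ ?_))
    simpa [ht] using hP
  have h0s : (0 : BMat A B) ∈ s :=
    ⟨Matrix.isHermitian_zero, by rw [map_zero]; simpa [opNorm] using hc⟩
  have hXP : ∀ P : BMat A B, P.PosSemidef → 0 ≤ hsInner X P := by
    intro P hP
    by_contra! hneg
    have h1 : ∀ a : ℝ, 0 ≤ a → 0 < hsInner X W + a * hsInner X P := by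
      intro a ha
      have := hsep 0 h0s _ (posSemidef_real_smul hP ha)
      rw [hsInner_smul_right] at this
      simpa [hsInner] using this
    -- This multiple of `P` turns the right-hand side into `⟨X, W⟩ - |⟨X, W⟩|`, which cannot be
    -- positive.
    have h2 := h1 (|hsInner X W| / -hsInner X P) (by
      have := abs_nonneg (hsInner X W)
      exact div_nonneg this (by linarith))
    have h3 : |hsInner X W| / -hsInner X P * hsInner X P = -|hsInner X W| := by
      rw [div_neg, neg_mul, div_mul_cancel₀ _ hneg.ne]
    rw [h3] at h2
    have h4 := h1 0 le_rfl
    rw [zero_mul, add_zero] at h4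
    rw [abs_of_pos h4] at h2
    linarith
  have hXpos : X.PosSemidef := posSemidef_of_hsInner_nonneg hX hXP
  have hXT := isHermitian_partialTranspose hX
  obtain ⟨-, -, U, -, -, -, -, hU, hU1, hUX⟩ := exists_jordan hXT
  -- With `U` the sign of `X^{T_B}`, this point of `s` pairs with `X` to exactly `c * ‖X^{T_B}‖₁`.
  have hQ : partialTranspose A B (c • U) ∈ s := by
    refine ⟨isHermitian_partialTranspose (isHermitian_real_smul hU c), ?_⟩
    rw [partialTranspose_partialTranspose, opNorm_smul, abs_of_nonneg hc]
    exact mul_le_of_le_one_right hc hU1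
  have hlt := hsep _ hQ 0 Matrix.PosSemidef.zero
  rw [← hsInner_partialTranspose, partialTranspose_partialTranspose, hsInner_smul_right,
    hsInner_comm, hUX] at hlt
  replace hlt : c * traceNorm (partialTranspose A B X) < hsInner W X := by
    rw [hsInner_comm W X]
    simpa [hsInner] using hlt
  -- If the trace norm vanishes, every nonnegative multiple of `X` is in the Rains set, and one of
  -- them pairs with `W` to `c + 1`. Otherwise `X` is normalised.
  rcases (traceNorm_nonneg hXT).eq_or_lt with h0 | hpos
  · rw [← h0, mul_zero] at hlt
    have h1 := h _ (smul_mem_rainsSet hXpos (c := (c + 1) / hsInner W X) (by positivity)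
      (by rw [← h0]; simp))
    rw [hsInner_smul_right, div_mul_cancel₀ _ hlt.ne'] at h1
    linarith
  · have h1 := h _ (smul_mem_rainsSet hXpos (c := (traceNorm (partialTranspose A B X))⁻¹)
      (by positivity) (by rw [inv_mul_cancel₀ hpos.ne']))
    rw [hsInner_smul_right, inv_mul_le_iff₀ hpos, mul_comm] at h1
    linarith

open scoped Pointwise in
theorem mem_smul_polar_iff {W : BMat A B} (hW : W.IsHermitian) {r : ℝ} (hr : 0 < r) :
    W ∈ r • polar (rainsSet A B) ↔ ∀ Y ∈ rainsSet A B, hsInner W Y ≤ r := by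
  rw [Set.mem_smul_set_iff_inv_smul_mem₀ hr.ne']
  simp only [polar, Set.mem_ofPred_eq, isHermitian_real_smul hW, true_and, hsInner_smul_left,
    inv_mul_le_iff₀ hr, mul_one]

open scoped Pointwise in
-- The gauge only sees positive scalings, so `c` is approached from above; this also covers `c = 0`.
theorem gammaRains_le_iff {W : BMat A B} (hW : W.IsHermitian) {c : ℝ} (hc : 0 ≤ c) :
    gammaRains W ≤ c ↔ ∀ Y ∈ rainsSet A B, hsInner W Y ≤ c := by
  constructor
  · intro h Y hY
    refine le_of_forall_gt_imp_ge_of_dense fun a ha => ?_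
    -- An infimum over the empty set would be the junk value `0`. Adding `1` to the norm keeps the
    -- scaling positive.
    have hne : {r : ℝ | 0 < r ∧ W ∈ r • polar (rainsSet A B)}.Nonempty := by
      have h0 := opNorm_nonneg (partialTranspose A B W)
      refine ⟨opNorm (partialTranspose A B W) + 1, by positivity,
        (mem_smul_polar_iff hW (by positivity)).mpr fun Y hY => ?_⟩
      have := hsInner_le_opNorm_partialTranspose hW
        (by rw [sub_self]; exact Matrix.PosSemidef.zero) hY
      linarith
    obtain ⟨r, ⟨hr, hrW⟩, hra⟩ := exists_lt_of_csInf_lt hne (h.trans_lt ha)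
    exact ((mem_smul_polar_iff hW hr).mp hrW Y hY).trans hra.le
  · intro h
    refine le_of_forall_gt_imp_ge_of_dense fun a ha => ?_
    have ha0 : 0 < a := hc.trans_lt ha
    exact gauge_le_of_mem ha0.le
      ((mem_smul_polar_iff hW ha0).mpr fun Y hY => (h Y hY).trans ha.le)

theorem gammaRains_nonneg (W : BMat A B) : 0 ≤ gammaRains W := gauge_nonneg _

/-- Weak duality gives the lower bound; strong duality at the threshold `gammaRains W` itself gives
attainment. -/
theorem isLeast_gammaRains {W : BMat A B} (hW : W.IsHermitian) :
    IsLeast {r : ℝ | ∃ Q : BMat A B, Q.IsHermitian ∧ (Q - W).PosSemidef ∧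
      r = opNorm (partialTranspose A B Q)} (gammaRains W) := by
  have hlow : ∀ Q : BMat A B, Q.IsHermitian → (Q - W).PosSemidef →
      gammaRains W ≤ opNorm (partialTranspose A B Q) := fun Q hQ hQW =>
    (gammaRains_le_iff hW (opNorm_nonneg _)).mpr fun Y hY =>
      hsInner_le_opNorm_partialTranspose hQ hQW hY
  constructor
  · obtain ⟨Q, hQ, hQW, hle⟩ := exists_opNorm_partialTranspose_le hW (gammaRains_nonneg W)
      ((gammaRains_le_iff hW (gammaRains_nonneg W)).mp le_rfl)
    exact ⟨Q, hQ, hQW, (hlow Q hQ hQW).antisymm hle⟩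
  · rintro r ⟨Q, hQ, hQW, rfl⟩
    exact hlow Q hQ hQW

theorem gammaRains_pos {W : BMat A B} (hW : W.PosSemidef) (hW0 : W ≠ 0) : 0 < gammaRains W := by
  refine (gammaRains_nonneg W).lt_of_ne fun h0 => hW0 ?_
  obtain ⟨Q, hQ, hQW, hr⟩ := (isLeast_gammaRains hW.isHermitian).1
  have hQ0 : Q = 0 := by
    rw [← partialTranspose_partialTranspose Q, eq_zero_of_opNorm_le_zero (hr.symm.trans h0.symm).le,
      map_zero]
  rw [hQ0, zero_sub] at hQW
  open scoped MatrixOrder in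
  exact le_antisymm (by simpa using hQW.nonneg) hW.nonneg

theorem gammaRains_le_one {W : BMat A B} (hW : W.IsHermitian) (h : (1 - W).PosSemidef) :
    gammaRains W ≤ 1 := by
  refine ((isLeast_gammaRains hW).2 ⟨1, Matrix.isHermitian_one, h, rfl⟩).trans ?_
  rw [partialTranspose_one]
  exact opNorm_one_le

end Duality

/-! ### Tensor powers and multiplicativity. -/

section TensorProd

variable {A B : Type*} {n : ℕ}

/-- The tensor product of a family of bipartite operators, as an operator of the bipartite system
with parts `A^n` and `B^n`. -/
def tensorProd (X : Fin n → BMat A B) : BMat (Fin n → A) (Fin n → B) :=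
  Matrix.of fun p q => ∏ i, X i (p.1 i, p.2 i) (q.1 i, q.2 i)

theorem tensorPow_eq_tensorProd (X : BMat A B) (n : ℕ) :
    tensorPow X n = tensorProd fun _ => X := rfl

theorem tensorProd_conjTranspose (X : Fin n → BMat A B) :
    (tensorProd X)ᴴ = tensorProd fun i => (X i)ᴴ := by
  ext p q
  simp [tensorProd]

theorem tensorPow_conjTranspose (X : BMat A B) : (tensorPow X n)ᴴ = tensorPow Xᴴ n :=
  tensorProd_conjTranspose _

theorem isHermitian_tensorPow {X : BMat A B} (hX : X.IsHermitian) :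
    (tensorPow X n).IsHermitian := by
  rw [Matrix.IsHermitian, tensorPow_conjTranspose, hX.eq]

theorem partialTranspose_tensorPow (X : BMat A B) :
    partialTranspose _ _ (tensorPow X n) = tensorPow (partialTranspose A B X) n := rfl

theorem tensorPow_smul (c : ℝ) (X : BMat A B) : tensorPow (c • X) n = c ^ n • tensorPow X n := by
  ext p q
  simp [tensorPow, Finset.prod_mul_distrib]

theorem tensorPow_one [DecidableEq A] [DecidableEq B] : tensorPow (1 : BMat A B) n = 1 := by
  ext p q
  simp only [tensorPow, Matrix.of_apply, Matrix.one_apply, Finset.prod_ite_zero, Prod.ext_iff,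
    funext_iff, Finset.mem_univ, true_implies, Finset.prod_const_one, forall_and]

theorem tensorPow_add (X Y : BMat A B) :
    tensorPow (X + Y) n =
      ∑ t : Finset (Fin n), tensorProd fun i => if i ∈ t then X else Y := by
  ext p q
  rw [Matrix.sum_apply]
  simp only [tensorPow, tensorProd, Matrix.of_apply, Matrix.add_apply, Finset.prod_add,
    Finset.powerset_univ]
  refine Finset.sum_congr rfl fun t _ => ?_
  rw [← Finset.prod_mul_prod_compl t, ← Finset.compl_eq_univ_sdiff]
  congr 1
  · exact Finset.prod_congr rfl fun i hi => by rw [if_pos hi]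
  · exact Finset.prod_congr rfl fun i hi => by rw [if_neg (Finset.mem_compl.mp hi)]

variable [Fintype A] [Fintype B]

theorem prod_sum_prod_eq {R : Type*} [CommSemiring R] (f : Fin n → A × B → R) :
    ∏ i, ∑ s, f i s = ∑ r : (Fin n → A) × (Fin n → B), ∏ i, f i (r.1 i, r.2 i) := by
  classical
  rw [Finset.prod_univ_sum, Fintype.piFinset_univ]
  exact Fintype.sum_equiv (Equiv.arrowProdEquivProdArrow (Fin n) (fun _ => A) (fun _ => B)) _ _
    fun _ => rfl

theorem tensorProd_mul (X Y : Fin n → BMat A B) :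
    tensorProd X * tensorProd Y = tensorProd fun i => X i * Y i := by
  ext p q
  simp only [Matrix.mul_apply, tensorProd, Matrix.of_apply, prod_sum_prod_eq,
    Finset.prod_mul_distrib]

theorem tensorPow_mul (X Y : BMat A B) : tensorPow X n * tensorPow Y n = tensorPow (X * Y) n :=
  tensorProd_mul _ _

theorem trace_tensorPow (X : BMat A B) : (tensorPow X n).trace = X.trace ^ n := by
  have h := prod_sum_prod_eq (n := n) fun _ (s : A × B) => X s s
  rw [Finset.prod_const, Finset.card_univ, Fintype.card_fin] at h
  exact h.symm

theorem posSemidef_tensorProd {X : Fin n → BMat A B} (hX : ∀ i, (X i).PosSemidef) :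
    (tensorProd X).PosSemidef := by
  choose C hC using fun i => exists_eq_conjTranspose_mul_self (hX i)
  rw [funext hC, ← tensorProd_mul, ← tensorProd_conjTranspose]
  exact Matrix.posSemidef_conjTranspose_mul_self _

theorem posSemidef_tensorPow {X : BMat A B} (hX : X.PosSemidef) : (tensorPow X n).PosSemidef :=
  posSemidef_tensorProd fun _ => hX

/-- Expand the power of `X + (Y - X)`: the term with `X` in every slot cancels, and the others are
tensor products of positive semidefinite factors. -/
theorem tensorPow_mono {X Y : BMat A B} (hX : X.PosSemidef) (hXY : (Y - X).PosSemidef) :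
    (tensorPow Y n - tensorPow X n).PosSemidef := by
  have h : tensorPow Y n - tensorPow X n =
      ∑ t ∈ Finset.univ.erase (Finset.univ : Finset (Fin n)),
        tensorProd fun i => if i ∈ t then X else Y - X := by
    have h1 := tensorPow_add (n := n) X (Y - X)
    rw [add_sub_cancel, ← Finset.add_sum_erase _ _ (Finset.mem_univ Finset.univ)] at h1
    rw [h1, sub_eq_iff_eq_add']
    simp [tensorPow_eq_tensorProd]
  rw [h]
  refine Matrix.posSemidef_sum _ fun t _ => posSemidef_tensorProd fun i => ?_
  split_ifs
  exacts [hX, hXY]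

theorem isState_tensorPow {ρ : BMat A B} (hρ : IsState ρ) (n : ℕ) : IsState (tensorPow ρ n) :=
  ⟨posSemidef_tensorPow hρ.1, by rw [trace_tensorPow, hρ.2, one_pow]⟩

theorem hsInner_tensorPow {X Y : BMat A B} (hX : X.PosSemidef) (hY : Y.PosSemidef) :
    hsInner (tensorPow X n) (tensorPow Y n) = hsInner X Y ^ n := by
  have h : (Xᴴ * Y).trace = (hsInner X Y : ℂ) :=
    Complex.ext rfl (Complex.nonneg_iff.mp (trace_conjTranspose_mul_nonneg hX hY)).2.symm
  rw [hsInner, tensorPow_conjTranspose, tensorPow_mul, trace_tensorPow, h, ← Complex.ofReal_pow,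
    Complex.ofReal_re]

variable [DecidableEq A] [DecidableEq B]

theorem opNorm_tensorPow_le (X : BMat A B) : opNorm (tensorPow X n) ≤ opNorm X ^ n := by
  rw [opNorm_le_iff (pow_nonneg (opNorm_nonneg X) n), tensorPow_conjTranspose, tensorPow_mul,
    pow_right_comm, ← tensorPow_one, ← tensorPow_smul]
  exact tensorPow_mono (Matrix.posSemidef_conjTranspose_mul_self X)
    ((opNorm_le_iff (opNorm_nonneg X)).mp le_rfl)

open scoped MatrixOrder in
theorem traceNorm_tensorPow (X : BMat A B) :
    traceNorm (tensorPow X n) = traceNorm X ^ n := by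
  have hpos : (CFC.abs X).PosSemidef := Matrix.nonneg_iff_posSemidef.mp (CFC.abs_nonneg X)
  -- By uniqueness of the positive square root.
  have habs : CFC.abs (tensorPow X n) = tensorPow (CFC.abs X) n := by
    refine CFC.sqrt_unique ?_ (posSemidef_tensorPow hpos).nonneg
    rw [tensorPow_mul, CFC.abs_mul_abs]
    exact ((congrArg (· * tensorPow X n) (tensorPow_conjTranspose X)).trans
      (tensorPow_mul _ _)).symm
  have htr : (CFC.abs X).trace = (traceNorm X : ℂ) :=
    Complex.ext rfl (Complex.nonneg_iff.mp hpos.trace_nonneg).2.symm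
  rw [traceNorm, habs, trace_tensorPow, htr, ← Complex.ofReal_pow, Complex.ofReal_re]

theorem tensorPow_mem_rainsSet {X : BMat A B} (hX : X ∈ rainsSet A B) :
    tensorPow X n ∈ rainsSet (Fin n → A) (Fin n → B) := by
  have hT := isHermitian_partialTranspose hX.1.isHermitian
  refine ⟨posSemidef_tensorPow hX.1, ?_⟩
  rw [partialTranspose_tensorPow, traceNorm_tensorPow]
  exact pow_le_one₀ (traceNorm_nonneg hT) hX.2

theorem gammaRains_tensorPow {W : BMat A B} (hW : W.PosSemidef) (n : ℕ) :
    gammaRains (tensorPow W n) = gammaRains W ^ n := by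
  have hWn := isHermitian_tensorPow (n := n) hW.isHermitian
  have hlow := (gammaRains_le_iff hWn (gammaRains_nonneg _)).mp le_rfl
  apply le_antisymm
  · obtain ⟨Q, hQ, hQW, hr⟩ := (isLeast_gammaRains hW.isHermitian).1
    refine ((isLeast_gammaRains hWn).2 ⟨tensorPow Q n, isHermitian_tensorPow hQ,
      tensorPow_mono hW hQW, rfl⟩).trans ?_
    rw [partialTranspose_tensorPow, hr]
    exact opNorm_tensorPow_le _
  · have hpow : ∀ Y ∈ rainsSet A B, hsInner W Y ^ n ≤ gammaRains (tensorPow W n) := by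
      intro Y hY
      rw [← hsInner_tensorPow hW hY.1]
      exact hlow _ (tensorPow_mem_rainsSet hY)
    rcases n.eq_zero_or_pos with rfl | hn
    -- For `n = 0` the point `Y = 0` suffices, since `0 ^ 0 = 1`.
    · simpa using hpow 0 zero_mem_rainsSet
    · have h0 := gammaRains_nonneg (tensorPow W n)
      -- Take `n`-th roots, so that the bounds on powers of single pairings become one bound on the
      -- support function.
      rw [← Real.rpow_inv_natCast_pow h0 hn.ne']
      refine pow_le_pow_left₀ (gammaRains_nonneg W) ?_ n
      refine (gammaRains_le_iff hW.isHermitian (Real.rpow_nonneg h0 _)).mpr fun Y hY => ?_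
      rw [← pow_le_pow_iff_left₀ (hsInner_nonneg hW hY.1) (Real.rpow_nonneg h0 _) hn.ne',
        Real.rpow_inv_natCast_pow h0 hn.ne']
      exact hpow Y hY

end TensorProd

/-! ### The support projector. -/

section SupportProj

variable {α : Type*} [Fintype α] [DecidableEq α]

/-- These algebraic properties characterise the projector (`eq_supportProj`) and pass to tensor
powers factor by factor. -/
theorem supportProj_spec (ρ : Matrix α α ℂ) :
    (supportProj ρ).IsHermitian ∧ supportProj ρ * ρ = ρ ∧ ∃ Z, supportProj ρ = ρ * Z := by
  set K := LinearMap.range (Matrix.toEuclideanCLM (n := α) (𝕜 := ℂ) ρ).toLinearMap with hK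
  have hP : Matrix.toEuclideanCLM (n := α) (𝕜 := ℂ) (supportProj ρ) = K.starProjection :=
    (Matrix.toEuclideanCLM (n := α) (𝕜 := ℂ)).apply_symm_apply _
  have hinj : ∀ {X Y : Matrix α α ℂ}, Matrix.toEuclideanCLM (n := α) (𝕜 := ℂ) X =
      Matrix.toEuclideanCLM (n := α) (𝕜 := ℂ) Y → X = Y := fun h =>
    (Matrix.toEuclideanCLM (n := α) (𝕜 := ℂ)).injective h
  refine ⟨?_, ?_, ?_⟩
  · apply hinj
    rw [← Matrix.star_eq_conjTranspose, map_star, hP]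
    exact isStarProjection_starProjection.isSelfAdjoint
  · apply hinj
    rw [map_mul, hP]
    ext1 v
    exact Submodule.starProjection_eq_self_iff.mpr ⟨v, rfl⟩
  · have h : ∀ j, ∃ z : EuclideanSpace ℂ α, Matrix.toEuclideanCLM (n := α) (𝕜 := ℂ) ρ z =
        Matrix.toEuclideanCLM (n := α) (𝕜 := ℂ) (supportProj ρ) (EuclideanSpace.single j 1) := by
      intro j
      rw [hP]
      exact K.starProjection_apply_mem _
    choose z hz using h
    refine ⟨Matrix.of fun i j => z j i, ?_⟩
    ext i j
    have h1 := congrArg (fun v : EuclideanSpace ℂ α => v i) (hz j)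
    simp only [Matrix.ofLp_toEuclideanCLM] at h1
    simpa [Matrix.mulVec, dotProduct, Matrix.mul_apply] using h1.symm

theorem eq_supportProj {ρ P : Matrix α α ℂ} (hP : P.IsHermitian) (hPρ : P * ρ = ρ)
    (hZ : ∃ Z, P = ρ * Z) : P = supportProj ρ := by
  obtain ⟨hS, hSρ, Y, hY⟩ := supportProj_spec ρ
  obtain ⟨Z, hZ⟩ := hZ
  have h1 : supportProj ρ * P = P := by
    conv_lhs => rw [hZ, ← Matrix.mul_assoc, hSρ]
    exact hZ.symm
  have h2 : P * supportProj ρ = supportProj ρ := by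
    conv_lhs => rw [hY, ← Matrix.mul_assoc, hPρ]
    exact hY.symm
  calc P = (supportProj ρ * P)ᴴ := by rw [h1, hP.eq]
    _ = supportProj ρ := by rw [Matrix.conjTranspose_mul, hP.eq, hS.eq, h2]

theorem isHermitian_supportProj (ρ : Matrix α α ℂ) : (supportProj ρ).IsHermitian :=
  (supportProj_spec ρ).1

theorem supportProj_mul_self (ρ : Matrix α α ℂ) :
    supportProj ρ * supportProj ρ = supportProj ρ := by
  obtain ⟨-, hSρ, Y, hY⟩ := supportProj_spec ρ
  conv_lhs => rw [hY, ← Matrix.mul_assoc, ← hY, hSρ]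
  exact hY.symm

theorem posSemidef_supportProj (ρ : Matrix α α ℂ) : (supportProj ρ).PosSemidef :=
  posSemidef_of_isHermitian_of_mul_self (isHermitian_supportProj ρ) (supportProj_mul_self ρ)

theorem posSemidef_one_sub_supportProj (ρ : Matrix α α ℂ) : (1 - supportProj ρ).PosSemidef :=
  posSemidef_one_sub_of_mul_self (isHermitian_supportProj ρ) (supportProj_mul_self ρ)

theorem supportProj_ne_zero {ρ : Matrix α α ℂ} (hρ : IsState ρ) : supportProj ρ ≠ 0 := by
  intro h
  have h1 := (supportProj_spec ρ).2.1
  rw [h, zero_mul] at h1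
  simpa [← h1] using hρ.2

theorem hsInner_supportProj {ρ : Matrix α α ℂ} (hρ : IsState ρ) :
    hsInner (supportProj ρ) ρ = 1 := by
  rw [hsInner, (isHermitian_supportProj ρ).eq, (supportProj_spec ρ).2.1, hρ.2, Complex.one_re]

/-- An effect which occurs with certainty in the state `ρ` dominates the support projector. -/
theorem posSemidef_sub_supportProj {ρ E : Matrix α α ℂ} (hρ : IsState ρ) (hE : E.PosSemidef)
    (hE1 : (1 - E).PosSemidef) (h : 1 ≤ hsInner ρ E) : (E - supportProj ρ).PosSemidef := by
  obtain ⟨hS, hSρ, Y, hY⟩ := supportProj_spec ρ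
  have h0 : hsInner ρ (1 - E) = 0 := by
    refine le_antisymm ?_ (hsInner_nonneg hρ.1 hE1)
    rw [hsInner_sub_right, hsInner_comm ρ 1, hsInner_one_left, hρ.2, Complex.one_re]
    linarith
  have h1 : (1 - E) * ρ = 0 := by
    have := congrArg Matrix.conjTranspose (mul_eq_zero_of_hsInner_eq_zero hρ.1 hE1 h0)
    rwa [Matrix.conjTranspose_mul, hE1.isHermitian.eq, hρ.1.isHermitian.eq,
      Matrix.conjTranspose_zero] at this
  have h2 : E * supportProj ρ = supportProj ρ := by
    have : (1 - E) * supportProj ρ = 0 := by rw [hY, ← Matrix.mul_assoc, h1, zero_mul]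
    rw [sub_mul, one_mul, sub_eq_zero] at this
    exact this.symm
  have h3 : supportProj ρ * E = supportProj ρ := by
    have := congrArg Matrix.conjTranspose h2
    rwa [Matrix.conjTranspose_mul, hE.isHermitian.eq, hS.eq] at this
  -- `E` acts as the identity on the support, so the difference is the compression of `E` to the
  -- orthogonal complement.
  have h4 : E - supportProj ρ = (1 - supportProj ρ)ᴴ * E * (1 - supportProj ρ) := by
    rw [Matrix.conjTranspose_sub, Matrix.conjTranspose_one, hS.eq, sub_mul, sub_mul, mul_sub,
      mul_sub, h3, one_mul, mul_one, mul_one, h2, supportProj_mul_self, sub_self, sub_zero]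
  rw [h4]
  exact hE.conjTranspose_mul_mul_same _

theorem supportProj_tensorPow {A B : Type*} [Fintype A] [Fintype B] [DecidableEq A]
    [DecidableEq B] (ρ : BMat A B) (n : ℕ) :
    supportProj (tensorPow ρ n) = tensorPow (supportProj ρ) n := by
  obtain ⟨hS, hSρ, Y, hY⟩ := supportProj_spec ρ
  refine (eq_supportProj (isHermitian_tensorPow hS) ?_ ⟨tensorPow Y n, ?_⟩).symm
  · rw [tensorPow_mul, hSρ]
  · rw [tensorPow_mul, ← hY]

end SupportProj

/-! ### Complete positivity of measure-and-prepare maps. -/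

section CompletelyPositive

variable {α β : Type*}

theorem IsCP.posSemidef_map {Λ : Matrix α α ℂ →ₗ[ℂ] Matrix β β ℂ} (hΛ : IsCP Λ)
    {X : Matrix α α ℂ} (hX : X.PosSemidef) : (Λ X).PosSemidef :=
  (hΛ 1 (X.submatrix Prod.snd Prod.snd) (hX.submatrix _)).submatrix fun b => (0, b)

theorem IsCP.add {Λ Λ' : Matrix α α ℂ →ₗ[ℂ] Matrix β β ℂ} (hΛ : IsCP Λ) (hΛ' : IsCP Λ') :
    IsCP (Λ + Λ') := fun k X hX => (hΛ k X hX).add (hΛ' k X hX)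

variable [Fintype α]

/-- The map `X ↦ Tr (E X) σ`. -/
def measurePrepare (E : Matrix α α ℂ) (σ : Matrix β β ℂ) : Matrix α α ℂ →ₗ[ℂ] Matrix β β ℂ :=
  (Matrix.traceLinearMap α ℂ ℂ ∘ₗ LinearMap.mulLeft ℂ E).smulRight σ

theorem measurePrepare_apply (E X : Matrix α α ℂ) (σ : Matrix β β ℂ) :
    measurePrepare E σ X = (E * X).trace • σ := rfl

theorem measurePrepare_eq_hsInner_smul {E X : Matrix α α ℂ} (hE : E.PosSemidef)
    (hX : X.PosSemidef) (σ : Matrix β β ℂ) : measurePrepare E σ X = hsInner E X • σ := by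
  have h : (E * X).trace = (hsInner E X : ℂ) := by
    have h1 := trace_conjTranspose_mul_nonneg hE hX
    rw [hsInner, hE.isHermitian.eq] at *
    exact Complex.ext rfl (Complex.nonneg_iff.mp h1).2.symm
  rw [measurePrepare_apply, h]
  ext i j
  simp

theorem isCP_measurePrepare [Finite β] {E : Matrix α α ℂ} {σ : Matrix β β ℂ} (hE : E.PosSemidef)
    (hσ : σ.PosSemidef) : IsCP (measurePrepare E σ) := by
  intro k X hX
  obtain ⟨C, rfl⟩ := exists_eq_conjTranspose_mul_self hE
  -- `D c` is the identity tensored with row `c` of `C`. These are Kraus operators of `id ⊗ Tr(E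
  -- ·)`, so the ampliation is a positive matrix tensored with `σ`.
  let D : α → Matrix (Fin k) (Fin k × α) ℂ := fun c => Matrix.of fun p r =>
    if p = r.1 then C c r.2 else 0
  have hM : (∑ c, D c * X * (D c)ᴴ).PosSemidef :=
    Matrix.posSemidef_sum _ fun c _ => hX.mul_mul_conjTranspose_same (D c)
  have hD : ∀ c (f : Fin k × α → ℂ) (p : Fin k),
      ∑ r, D c p r * f r = ∑ a, C c a * f (p, a) := by
    intro c f p
    simp [D, Fintype.sum_prod_type]
  have hD' : ∀ c (f : Fin k × α → ℂ) (p : Fin k),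
      ∑ r, f r * star (D c p r) = ∑ a, f (p, a) * star (C c a) := by
    intro c f p
    simp only [Fintype.sum_prod_type]
    rw [Finset.sum_eq_single p]
    · simp [D]
    · intro r _ hr
      simp [D, hr.symm]
    · simp
  have h : ampliation (Fin k) (measurePrepare (Cᴴ * C) σ) X =
      Matrix.kroneckerMap (· * ·) (∑ c, D c * X * (D c)ᴴ) σ := by
    ext p q
    simp only [ampliation, Matrix.of_apply, measurePrepare_apply, Matrix.smul_apply, smul_eq_mul,
      Matrix.kroneckerMap_apply]
    congr 1
    rw [Matrix.trace_mul_comm, ← Matrix.mul_assoc, Matrix.trace_mul_comm, ← Matrix.mul_assoc]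
    simp only [Matrix.sum_apply, Matrix.mul_apply, Matrix.conjTranspose_apply, hD', hD,
      Matrix.trace, Matrix.diag, Matrix.of_apply]
  rw [h]
  exact hM.kronecker hσ

end CompletelyPositive

/-! ### PPT operations and the Rains set. -/

section RainsPreserving

variable {A B A' B' : Type*} [Fintype A] [Fintype B] [Fintype A'] [Fintype B'] [DecidableEq A]
  [DecidableEq B] [DecidableEq A'] [DecidableEq B']

/-- The conjugated map `T ∘ Λ ∘ T` is positive and trace-preserving, hence does not increase the
trace norm of `X^{T_B}`, as its Jordan parts show. -/
theorem pptOperations_subset_rainsPreserving :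
    pptOperations A B A' B' ⊆ rainsPreserving A B A' B' := by
  rintro Λ ⟨hΛ, hT⟩
  refine ⟨hΛ, fun X hX => ⟨hΛ.1.posSemidef_map hX.1, ?_⟩⟩
  obtain ⟨P, N, -, hP, hN, hPN, hnorm, -⟩ :=
    exists_jordan (isHermitian_partialTranspose hX.1.isHermitian)
  set Θ := partialTranspose A' B' ∘ₗ Λ ∘ₗ partialTranspose A B with hΘ
  have htr : ∀ Y, (Θ Y).trace = Y.trace := fun Y => by
    simp only [hΘ, LinearMap.comp_apply, trace_partialTranspose, hΛ.2]
  have h1 : partialTranspose A' B' (Λ X) = Θ P - Θ N := by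
    rw [← map_sub, ← hPN]
    rfl
  rw [h1]
  refine (traceNorm_sub_le (hT.posSemidef_map hP) (hT.posSemidef_map hN)).trans ?_
  rw [htr, htr, ← hnorm]
  exact hX.2

theorem trace_le_one_of_mem_rainsSet {X : BMat A B} (hX : X ∈ rainsSet A B) :
    hsInner 1 X ≤ 1 := by
  refine (hsInner_le_opNorm_partialTranspose Matrix.isHermitian_one
    (by rw [sub_self]; exact Matrix.PosSemidef.zero) hX).trans ?_
  rw [partialTranspose_one]
  exact opNorm_one_le

end RainsPreserving

/-! ### Maximally entangled and isotropic states. -/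

section MaximallyEntangled

variable {m : ℕ}

/-- The swap operator on `ℂ^m ⊗ ℂ^m`. -/
def swapOp (m : ℕ) : BMat (Fin m) (Fin m) :=
  Matrix.of fun p q => if p = q.swap then 1 else 0

theorem isHermitian_swapOp : (swapOp m).IsHermitian := by
  ext p q
  have : q = p.swap ↔ p = q.swap := by rw [← Prod.swap_inj, Prod.swap_swap, eq_comm]
  simp [swapOp, this]

theorem swapOp_mul_self : swapOp m * swapOp m = 1 := by
  ext p q
  have h : ∀ r : Fin m × Fin m, p = r.swap ↔ r = p.swap := fun r => by
    rw [← Prod.swap_inj, Prod.swap_swap, eq_comm]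
  simp [swapOp, Matrix.mul_apply, Matrix.one_apply, h, eq_comm]

theorem trace_swapOp : (swapOp m).trace = m := by
  have h : ∀ a b : Fin m, (a, b) = (b, a) ↔ a = b := fun a b => by
    simp [Prod.ext_iff, eq_comm]
  simp only [swapOp, Matrix.trace, Matrix.diag, Matrix.of_apply, Fintype.sum_prod_type,
    Prod.swap_prod_mk, h]
  simp

theorem posSemidef_of_mul_self_eq_two_smul {α : Type*} [Fintype α] {P : Matrix α α ℂ}
    (hP : P.IsHermitian) (h : P * P = (2 : ℝ) • P) : P.PosSemidef := by
  have h1 := posSemidef_real_smul (Matrix.posSemidef_conjTranspose_mul_self P)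
    (c := (2 : ℝ)⁻¹) (by norm_num)
  rwa [hP.eq, h, smul_smul, inv_mul_cancel₀ two_ne_zero, one_smul] at h1

theorem posSemidef_one_add_swapOp : (1 + swapOp m).PosSemidef :=
  posSemidef_of_mul_self_eq_two_smul (Matrix.isHermitian_one.add isHermitian_swapOp) (by
    rw [add_mul, mul_add, mul_add, swapOp_mul_self, one_mul, one_mul, mul_one]
    module)

theorem posSemidef_one_sub_swapOp : (1 - swapOp m).PosSemidef :=
  posSemidef_of_mul_self_eq_two_smul (Matrix.isHermitian_one.sub isHermitian_swapOp) (by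
    rw [sub_mul, mul_sub, mul_sub, swapOp_mul_self, one_mul, one_mul, mul_one]
    module)

theorem opNorm_swapOp_le : opNorm (swapOp m) ≤ 1 := by
  rw [opNorm_le_iff zero_le_one, isHermitian_swapOp.eq, swapOp_mul_self]
  simpa using Matrix.PosSemidef.zero

theorem partialTranspose_maxEnt :
    partialTranspose _ _ (maxEnt m) = (m : ℝ)⁻¹ • swapOp m := by
  ext p q
  have h : (Real.sqrt m : ℂ)⁻¹ * (Real.sqrt m : ℂ)⁻¹ = (m : ℂ)⁻¹ := by
    rw [← mul_inv, ← Complex.ofReal_mul, Real.mul_self_sqrt m.cast_nonneg, Complex.ofReal_natCast]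
  by_cases h1 : p.1 = q.2 <;> by_cases h2 : p.2 = q.1 <;>
    simp [partialTranspose_apply, maxEnt, Matrix.vecMulVec_apply, maxEntVec, swapOp, Prod.ext_iff,
      h1, h2, h, eq_comm (a := q.1)]

theorem posSemidef_maxEnt : (maxEnt m).PosSemidef :=
  Matrix.posSemidef_vecMulVec_self_star _

theorem trace_maxEnt (hm : 1 ≤ m) : (maxEnt m).trace = 1 := by
  rw [← trace_partialTranspose, partialTranspose_maxEnt, Matrix.trace_smul, trace_swapOp]
  have : (m : ℂ) ≠ 0 := by exact_mod_cast (by omega : m ≠ 0)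
  simp [this]

theorem maxEnt_mul_self (hm : 1 ≤ m) : maxEnt m * maxEnt m = maxEnt m := by
  have h : star (maxEntVec m) ⬝ᵥ maxEntVec m = 1 := by
    rw [← trace_maxEnt hm, maxEnt, Matrix.trace_vecMulVec, dotProduct_comm]
  rw [maxEnt, Matrix.vecMulVec_mul_vecMulVec, h]
  simp

theorem posSemidef_one_sub_maxEnt (hm : 1 ≤ m) : (1 - maxEnt m).PosSemidef :=
  posSemidef_one_sub_of_mul_self posSemidef_maxEnt.isHermitian (maxEnt_mul_self hm)

/-- The partial transpose of `Ψ_m` is the swap divided by `m`, of operator norm at most `1 / m`. -/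
theorem hsInner_maxEnt_le {X : BMat (Fin m) (Fin m)} (hX : X ∈ rainsSet (Fin m) (Fin m)) :
    hsInner X (maxEnt m) ≤ 1 / m := by
  rw [hsInner_comm]
  refine (hsInner_le_opNorm_partialTranspose posSemidef_maxEnt.isHermitian
    (by rw [sub_self]; exact Matrix.PosSemidef.zero) hX).trans ?_
  rw [partialTranspose_maxEnt, opNorm_smul, abs_of_nonneg (by positivity), one_div]
  exact mul_le_of_le_one_right (by positivity) opNorm_swapOp_le

theorem trace_one_prod_fin : (1 : BMat (Fin m) (Fin m)).trace = (m : ℂ) ^ 2 := by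
  simp [sq]

/-- An isotropic state orthogonal to `Ψ_m`, if `m > 1`, such that its mixtures with `Ψ_m` belong to
the Rains set as soon as their overlap with `Ψ_m` is at most `1 / m`. -/
theorem exists_isotropic (hm : 1 ≤ m) : ∃ σ : BMat (Fin m) (Fin m), σ.PosSemidef ∧ σ.trace = 1 ∧
    ∀ a b : ℝ, 0 ≤ a → 0 ≤ b → a + b ≤ 1 → a ≤ 1 / m →
      a • maxEnt m + b • σ ∈ rainsSet (Fin m) (Fin m) := by
  rcases hm.eq_or_lt with rfl | hm1
  -- For `m = 1` there is no orthogonal complement to normalise, and `Ψ_1` is the only state.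
  · refine ⟨maxEnt 1, posSemidef_maxEnt, trace_maxEnt le_rfl, fun a b ha hb hab _ => ?_⟩
    rw [← add_smul]
    refine smul_mem_rainsSet posSemidef_maxEnt (add_nonneg ha hb) ?_
    have h : partialTranspose _ _ (maxEnt 1) = maxEnt 1 := by
      ext p q
      rw [partialTranspose_apply]
      congr 1 <;> exact Subsingleton.elim _ _
    have h1 := traceNorm_le_of_posSemidef (posSemidef_maxEnt (m := 1))
    rw [trace_maxEnt le_rfl, Complex.one_re] at h1
    rw [h]
    nlinarith [add_nonneg ha hb]
  · set M : ℝ := (m : ℝ) with hM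
    have hM1 : 1 < M := Nat.one_lt_cast.mpr hm1
    have hM0 : 0 < M := by linarith
    have hMm : 0 < M - 1 := by linarith
    have hMp : 0 < M + 1 := by linarith
    have hM2 : 0 < M ^ 2 - 1 := by nlinarith
    have hσ : ((M ^ 2 - 1)⁻¹ • (1 - maxEnt m)).PosSemidef :=
      posSemidef_real_smul (posSemidef_one_sub_maxEnt hm) (by positivity)
    have htS : (1 + swapOp m).trace.re = M ^ 2 + M := by
      rw [Matrix.trace_add, trace_one_prod_fin, trace_swapOp]
      simp [sq, hM]
    have htN : (1 - swapOp m).trace.re = M ^ 2 - M := by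
      rw [Matrix.trace_sub, trace_one_prod_fin, trace_swapOp]
      simp [sq, hM]
    refine ⟨(M ^ 2 - 1)⁻¹ • (1 - maxEnt m), hσ, ?_, fun a b ha hb hab ham => ?_⟩
    · rw [Matrix.trace_smul, Matrix.trace_sub, trace_one_prod_fin, trace_maxEnt hm]
      have : ((m : ℂ) ^ 2 - 1) = ((M ^ 2 - 1 : ℝ) : ℂ) := by simp [hM]
      rw [this, Complex.real_smul, ← Complex.ofReal_mul, inv_mul_cancel₀ hM2.ne',
        Complex.ofReal_one]
    · refine ⟨(posSemidef_real_smul posSemidef_maxEnt ha).add (posSemidef_real_smul hσ hb), ?_⟩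
      have hPT : partialTranspose _ _ (a • maxEnt m + b • (M ^ 2 - 1)⁻¹ • (1 - maxEnt m)) =
          ((a / M + b / (M * (M + 1))) / 2) • (1 + swapOp m) -
            ((a / M - b / (M * (M - 1))) / 2) • (1 - swapOp m) := by
        rw [map_add, partialTranspose_real_smul, partialTranspose_real_smul,
          partialTranspose_real_smul, map_sub, partialTranspose_one, partialTranspose_maxEnt, ← hM,
          show M ^ 2 - 1 = (M - 1) * (M + 1) by ring]
        match_scalars <;> field_simp <;> ring
      rw [hPT]
      have hα : 0 ≤ (a / M + b / (M * (M + 1))) / 2 := by positivity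
      -- The sign of the antisymmetric coefficient decides which hypothesis is used: the bound on
      -- the trace norm is `a * M` in the first case and `a + b` in the second.
      rcases le_total 0 ((a / M - b / (M * (M - 1))) / 2) with hβ | hβ
      · refine (traceNorm_sub_le (posSemidef_real_smul posSemidef_one_add_swapOp hα)
          (posSemidef_real_smul posSemidef_one_sub_swapOp hβ)).trans ?_
        rw [Matrix.trace_smul, Matrix.trace_smul, Complex.smul_re, Complex.smul_re, htS, htN]
        rw [le_div_iff₀ hM0] at ham
        refine le_trans (le_of_eq ?_) ham
        simp only [smul_eq_mul]
        field_simp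
        ring
      · rw [sub_eq_add_neg, ← neg_smul]
        refine (traceNorm_le_of_posSemidef ((posSemidef_real_smul posSemidef_one_add_swapOp hα).add
          (posSemidef_real_smul posSemidef_one_sub_swapOp (neg_nonneg.mpr hβ)))).trans ?_
        rw [Matrix.trace_add, Complex.add_re, Matrix.trace_smul, Matrix.trace_smul, Complex.smul_re,
          Complex.smul_re, htS, htN]
        refine le_trans (le_of_eq ?_) hab
        simp only [smul_eq_mul]
        field_simp
        ring

theorem hsInner_maxEnt_le_one {α : Type*} [Fintype α] {ρ : Matrix α α ℂ} (hm : 1 ≤ m) (hρ : IsState ρ)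
    {Λ : Matrix α α ℂ →ₗ[ℂ] BMat (Fin m) (Fin m)} (hΛ : IsCPTP Λ) :
    hsInner (Λ ρ) (maxEnt m) ≤ 1 := by
  rw [hsInner_comm]
  refine (hsInner_mono_left (posSemidef_one_sub_maxEnt hm) (hΛ.1.posSemidef_map hρ.1)).trans ?_
  rw [hsInner_one_left, hΛ.2, hρ.2, Complex.one_re]

end MaximallyEntangled

/-! ### One-shot zero-error distillation. -/

section Distillation

variable {A B : Type*} [Fintype A] [Fintype B] [DecidableEq A] [DecidableEq B] {m : ℕ}
  {ρ : BMat A B}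

theorem bddAbove_fidelity (hm : 1 ≤ m) (hρ : IsState ρ) :
    BddAbove ((fun Λ => hsInner (Λ ρ) (maxEnt m)) ''
      rainsPreserving A B (Fin m) (Fin m)) := by
  refine ⟨1, ?_⟩
  rintro _ ⟨Λ, hΛ, rfl⟩
  exact hsInner_maxEnt_le_one hm hρ hΛ.1

/-- The effect `Λ†(Ψ_m)` of a Rains-preserving operation `Λ`. -/
theorem exists_effect (hm : 1 ≤ m) {Λ : BMat A B →ₗ[ℂ] BMat (Fin m) (Fin m)}
    (hΛ : Λ ∈ rainsPreserving A B (Fin m) (Fin m)) :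
    ∃ E : BMat A B, E.PosSemidef ∧ (1 - E).PosSemidef ∧
      (∀ Y ∈ rainsSet A B, hsInner E Y ≤ 1 / m) ∧
      ∀ X : BMat A B, X.IsHermitian → hsInner (Λ X) (maxEnt m) = hsInner E X := by
  let f : BMat A B →ₗ[ℝ] ℝ :=
    { toFun := fun X => hsInner (Λ X) (maxEnt m)
      map_add' := fun X Y => by rw [map_add, hsInner_add_left]
      map_smul' := fun c X => by
        rw [LinearMap.map_smul_of_tower, hsInner_smul_left]
        rfl }
  obtain ⟨E, hE, hEf⟩ := exists_hsInner_eq f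
  replace hEf : ∀ X : BMat A B, X.IsHermitian → hsInner (Λ X) (maxEnt m) = hsInner E X := hEf
  refine ⟨E, ?_, ?_, ?_, hEf⟩
  · refine posSemidef_of_hsInner_nonneg hE fun P hP => ?_
    rw [← hEf P hP.isHermitian]
    exact hsInner_nonneg (hΛ.1.1.posSemidef_map hP) posSemidef_maxEnt
  · refine posSemidef_of_hsInner_nonneg (Matrix.isHermitian_one.sub hE) fun P hP => ?_
    have h := hsInner_nonneg (posSemidef_one_sub_maxEnt hm) (hΛ.1.1.posSemidef_map hP)
    rw [hsInner_sub_left, hsInner_one_left, hΛ.1.2, hsInner_comm, hEf P hP.isHermitian] at h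
    rwa [hsInner_sub_left, hsInner_one_left]
  · intro Y hY
    rw [← hEf Y hY.1.isHermitian]
    exact hsInner_maxEnt_le (hΛ.2 Y hY)

theorem opNorm_le_one_of_posSemidef {α : Type*} [Fintype α] [DecidableEq α] {E : Matrix α α ℂ}
    (hE : E.PosSemidef) (hE1 : (1 - E).PosSemidef) : opNorm E ≤ 1 := by
  rw [opNorm_le_iff zero_le_one]
  have h1 := hE1.conjTranspose_mul_mul_same E
  have h2 := hE.conjTranspose_mul_mul_same (1 - E)
  -- The last two summands add up to `E - E²`.
  have h3 : (1 : ℝ) ^ 2 • (1 : Matrix α α ℂ) - Eᴴ * E =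
      (1 - E) + (Eᴴ * (1 - E) * E + (1 - E)ᴴ * E * (1 - E)) := by
    rw [hE1.isHermitian.eq, hE.isHermitian.eq, one_pow, one_smul]
    noncomm_ring
  rw [h3]
  exact hE1.add (h1.add h2)

/-- The fidelity is only a supremum over channels; compactness of the admissible effects supplies an
effect whose overlap with `ρ` is at least that supremum. -/
theorem isCompact_effects (c : ℝ) :
    IsCompact {E : BMat A B | E.PosSemidef ∧ (1 - E).PosSemidef ∧
      ∀ Y ∈ rainsSet A B, hsInner E Y ≤ c} := by
  refine (isCompact_entrywise_le (A × B) 1).of_isClosed_subset ?_ fun E hE p q =>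
    (norm_apply_le_opNorm E p q).trans (opNorm_le_one_of_posSemidef hE.1 hE.2.1)
  simp only [Set.ofPred_and, Set.ofPred_forall]
  refine (isClosed_posSemidef _).inter (((isClosed_posSemidef _).preimage
    (continuous_const.sub continuous_id)).inter
    (isClosed_iInter fun Y => isClosed_iInter fun _ => isClosed_le ?_ continuous_const))
  simp only [fun E => hsInner_comm E Y]
  exact continuous_hsInner_right Y

theorem one_le_fidelity_iff (hm : 1 ≤ m) (hρ : IsState ρ) :
    1 ≤ fidelity (rainsPreserving A B (Fin m) (Fin m)) ρ ↔
      gammaRains (supportProj ρ) ≤ 1 / m := by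
  have hS := isHermitian_supportProj ρ
  have hm0 : (0 : ℝ) ≤ 1 / m := by positivity
  rw [gammaRains_le_iff hS hm0]
  constructor
  · intro h
    obtain ⟨E, ⟨hE, hE1, hEY⟩, hmax⟩ := (isCompact_effects (A := A) (B := B) (1 / m)).exists_isMaxOn
      ⟨0, Matrix.PosSemidef.zero, by rw [sub_zero]; exact Matrix.PosSemidef.one,
        fun Y _ => by simp [hsInner]⟩ (continuous_hsInner_right ρ).continuousOn
    have h1 : fidelity (rainsPreserving A B (Fin m) (Fin m)) ρ ≤ hsInner ρ E := by
      refine Real.sSup_le ?_ (hsInner_nonneg hρ.1 hE)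
      rintro _ ⟨Λ, hΛ, rfl⟩
      obtain ⟨E', hE', hE1', hEY', heq⟩ := exists_effect hm hΛ
      dsimp only
      rw [heq ρ hρ.1.isHermitian, hsInner_comm]
      exact hmax ⟨hE', hE1', hEY'⟩
    intro Y hY
    exact (hsInner_mono_left (posSemidef_sub_supportProj hρ hE hE1 (h.trans h1)) hY.1).trans
      (hEY Y hY)
  · intro h
    obtain ⟨σ, hσ, hσ1, hmix⟩ := exists_isotropic hm
    have hP := posSemidef_supportProj ρ
    have hP1 := posSemidef_one_sub_supportProj ρ
    -- The weights of `Ψ_m` and `σ` in the output are the two outcome probabilities; `h` bounds the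
    -- first by `1 / m` on the Rains set, as `hmix` requires.
    set Λ := measurePrepare (supportProj ρ) (maxEnt m) + measurePrepare (1 - supportProj ρ) σ
      with hΛ
    have hΛX : ∀ X : BMat A B, X.PosSemidef → Λ X =
        hsInner (supportProj ρ) X • maxEnt m + hsInner (1 - supportProj ρ) X • σ := by
      intro X hX
      rw [hΛ, LinearMap.add_apply, measurePrepare_eq_hsInner_smul hP hX,
        measurePrepare_eq_hsInner_smul hP1 hX]
    have hmem : Λ ∈ rainsPreserving A B (Fin m) (Fin m) := by
      refine ⟨⟨(isCP_measurePrepare hP posSemidef_maxEnt).add (isCP_measurePrepare hP1 hσ),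
        fun X => ?_⟩, fun X hX => ?_⟩
      · rw [hΛ, LinearMap.add_apply, measurePrepare_apply, measurePrepare_apply, Matrix.trace_add,
          Matrix.trace_smul, Matrix.trace_smul, hσ1, trace_maxEnt hm, ← add_smul,
          ← Matrix.trace_add, ← add_mul]
        simp
      · rw [hΛX X hX.1]
        refine hmix _ _ (hsInner_nonneg hP hX.1) (hsInner_nonneg hP1 hX.1) ?_ (h X hX)
        rw [← hsInner_add_left, add_sub_cancel]
        exact trace_le_one_of_mem_rainsSet hX
    refine le_csSup_of_le (bddAbove_fidelity hm hρ) ⟨Λ, hmem, rfl⟩ (le_of_eq ?_)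
    have h1 : hsInner (1 - supportProj ρ) ρ = 0 := by
      rw [hsInner_sub_left, hsInner_supportProj hρ, hsInner_one_left, hρ.2, Complex.one_re,
        sub_self]
    dsimp only
    rw [hΛX ρ hρ.1, hsInner_supportProj hρ, h1, one_smul, zero_smul, add_zero, hsInner,
      posSemidef_maxEnt.isHermitian.eq, maxEnt_mul_self hm, trace_maxEnt hm, Complex.one_re]

end Distillation

/-! ### Rounding to integers and the asymptotic limit. -/

section Asymptotics

open Filter Topology

theorem oneShotDistillable_mono {A B : Type*} [Fintype A] [Fintype B] [DecidableEq A]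
    [DecidableEq B] {𝒪 : ∀ m : ℕ, Set (BMat A B →ₗ[ℂ] BMat (Fin m) (Fin m))}
    (h : ∀ m, 𝒪 m ⊆ rainsPreserving A B (Fin m) (Fin m)) {ρ : BMat A B} (hρ : IsState ρ) :
    oneShotDistillable 𝒪 0 ρ ≤
      oneShotDistillable (fun m => rainsPreserving A B (Fin m) (Fin m)) 0 ρ := by
  refine biSup_mono fun m ⟨hm, hF⟩ => ⟨hm, hF.trans ?_⟩
  -- An empty class has fidelity `sSup ∅ = 0`, so it never reaches the threshold `1`.
  rcases (𝒪 m).eq_empty_or_nonempty with h0 | hne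
  · rw [fidelity, h0, Set.image_empty, Real.sSup_empty, sub_zero] at hF
    linarith
  · exact csSup_le_csSup (bddAbove_fidelity hm hρ) (hne.image _) (Set.image_mono (h m))

/-- Rounding down a number that is at least `1` loses less than a factor of two, hence at most one
bit. -/
theorem logb_two_inv_sub_one_le_logb_floor {x : ℝ} (hx : 0 < x) (hx1 : x ≤ 1) :
    -Real.logb 2 x - 1 ≤ Real.logb 2 (⌊x⁻¹⌋₊ : ℝ) := by
  have h1 : 1 ≤ x⁻¹ := (one_le_inv₀ hx).mpr hx1
  have h2 : (1 : ℝ) ≤ ⌊x⁻¹⌋₊ := by exact_mod_cast Nat.one_le_floor_iff _ |>.mpr h1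
  have h3 : x⁻¹ / 2 ≤ ⌊x⁻¹⌋₊ := by
    have := Nat.lt_floor_add_one x⁻¹
    linarith
  calc -Real.logb 2 x - 1 = Real.logb 2 (x⁻¹ / 2) := by
        rw [Real.logb_div (by positivity) two_ne_zero, Real.logb_inv,
          Real.logb_self_eq_one one_lt_two]
    _ ≤ _ := Real.logb_le_logb_of_le one_lt_two (by positivity) h3

variable {A B : Type*} [Fintype A] [Fintype B] [DecidableEq A] [DecidableEq B] {ρ : BMat A B}

theorem gammaRains_supportProj_pos (hρ : IsState ρ) : 0 < gammaRains (supportProj ρ) :=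
  gammaRains_pos (posSemidef_supportProj ρ) (supportProj_ne_zero hρ)

theorem oneShotDistillable_rainsPreserving_le (hρ : IsState ρ) :
    oneShotDistillable (fun m => rainsPreserving A B (Fin m) (Fin m)) 0 ρ ≤
      ((-Real.logb 2 (gammaRains (supportProj ρ)) : ℝ) : EReal) := by
  refine iSup₂_le fun m ⟨hm, hF⟩ => ?_
  rw [sub_zero, one_le_fidelity_iff hm hρ] at hF
  have hm0 : (0 : ℝ) < m := by exact_mod_cast hm
  have h := Real.logb_le_logb_of_le one_lt_two (gammaRains_supportProj_pos hρ) hF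
  rw [one_div, Real.logb_inv] at h
  exact EReal.coe_le_coe_iff.mpr (by linarith)

theorem le_oneShotDistillable_rainsPreserving (hρ : IsState ρ) :
    ((-Real.logb 2 (gammaRains (supportProj ρ)) - 1 : ℝ) : EReal) ≤
      oneShotDistillable (fun m => rainsPreserving A B (Fin m) (Fin m)) 0 ρ := by
  have hpos := gammaRains_supportProj_pos hρ
  have hle := gammaRains_le_one (isHermitian_supportProj ρ) (posSemidef_one_sub_supportProj ρ)
  have hfl : 1 ≤ ⌊(gammaRains (supportProj ρ))⁻¹⌋₊ :=
    (Nat.one_le_floor_iff _).mpr ((one_le_inv₀ hpos).mpr hle)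
  refine (EReal.coe_le_coe_iff.mpr (logb_two_inv_sub_one_le_logb_floor hpos hle)).trans ?_
  refine le_iSup₂_of_le ⌊(gammaRains (supportProj ρ))⁻¹⌋₊ ⟨hfl, ?_⟩ le_rfl
  rw [sub_zero, one_le_fidelity_iff hfl hρ, one_div]
  exact le_inv_of_le_inv₀ (by exact_mod_cast hfl) (Nat.floor_le (by positivity))

theorem asymptoticZeroError_rainsPreserving (hρ : IsState ρ) :
    asymptoticZeroError
        (fun n m => rainsPreserving (Fin n → A) (Fin n → B) (Fin m) (Fin m)) ρ =
      ((-Real.logb 2 (gammaRains (supportProj ρ)) : ℝ) : EReal) := by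
  set L : ℝ := -Real.logb 2 (gammaRains (supportProj ρ)) with hL
  have hlog : ∀ n : ℕ, -Real.logb 2 (gammaRains (supportProj (tensorPow ρ n))) = n * L := by
    intro n
    rw [supportProj_tensorPow, gammaRains_tensorPow (posSemidef_supportProj ρ), Real.logb_pow, hL]
    ring
  have hlower : Tendsto (fun n : ℕ => ((L - 1 / (n : ℝ) : ℝ) : EReal)) atTop (𝓝 (L : EReal)) := by
    rw [EReal.tendsto_coe]
    simpa using tendsto_const_nhds.sub (tendsto_one_div_atTop_nhds_zero_nat (𝕜 := ℝ))
  -- The normalised rate lies between `L - 1 / n` and `L`, so the limsup is a genuine limit.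
  refine Tendsto.limsup_eq (tendsto_of_tendsto_of_tendsto_of_le_of_le' hlower tendsto_const_nhds
    ?_ ?_)
  · filter_upwards [eventually_gt_atTop 0] with n hn
    have hn0 : (0 : ℝ) < n := by exact_mod_cast hn
    have h := le_oneShotDistillable_rainsPreserving (isState_tensorPow hρ n)
    rw [hlog] at h
    refine le_trans (le_of_eq ?_) (mul_le_mul_of_nonneg_left h
      (EReal.coe_nonneg.mpr (by positivity : (0 : ℝ) ≤ 1 / n)))
    rw [← EReal.coe_mul]
    congr 1
    field_simp
  · filter_upwards [eventually_gt_atTop 0] with n hn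
    have hn0 : (0 : ℝ) < n := by exact_mod_cast hn
    have h := oneShotDistillable_rainsPreserving_le (isState_tensorPow hρ n)
    rw [hlog] at h
    refine (mul_le_mul_of_nonneg_left h
      (EReal.coe_nonneg.mpr (by positivity : (0 : ℝ) ≤ 1 / n))).trans (le_of_eq ?_)
    rw [← EReal.coe_mul]
    congr 1
    field_simp

theorem asymptoticZeroError_le_of_subset_pptOperations (hρ : IsState ρ)
    {𝒪 : ∀ n m : ℕ, Set (BMat (Fin n → A) (Fin n → B) →ₗ[ℂ] BMat (Fin m) (Fin m))}
    (h : ∀ n m, 𝒪 n m ⊆ pptOperations (Fin n → A) (Fin n → B) (Fin m) (Fin m)) :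
    asymptoticZeroError 𝒪 ρ ≤ ((-Real.logb 2 (gammaRains (supportProj ρ)) : ℝ) : EReal) := by
  rw [← asymptoticZeroError_rainsPreserving hρ]
  refine limsup_le_limsup (Eventually.of_forall fun n => ?_)
  exact mul_le_mul_of_nonneg_left
    (oneShotDistillable_mono (fun m => (h n m).trans pptOperations_subset_rainsPreserving)
      (isState_tensorPow hρ n))
    (EReal.coe_nonneg.mpr (by positivity))

end Asymptotics

end ZeroErrorRains

end

theorem mainTheorem12 {A B : Type*} [Fintype A] [Fintype B] [DecidableEq A] [DecidableEq B]
    (ρ : ZeroErrorRains.BMat A B) (hρ : ZeroErrorRains.IsState ρ) :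
    -- positivity, so that the logarithm below is a genuine one
    0 < ZeroErrorRains.gammaRains (ZeroErrorRains.supportProj ρ) ∧
    -- the asymptotic zero-error distillable entanglement under Rains-preserving operations
    ZeroErrorRains.asymptoticZeroError
        (fun n m =>
          ZeroErrorRains.rainsPreserving (Fin n → A) (Fin n → B) (Fin m) (Fin m)) ρ =
      ((-Real.logb 2 (ZeroErrorRains.gammaRains (ZeroErrorRains.supportProj ρ)) : ℝ) : EReal) ∧
    -- the dual form of the gauge function, with the minimum attained
    IsLeast
      {r : ℝ | ∃ Q : ZeroErrorRains.BMat A B, Q.IsHermitian ∧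
        (Q - ZeroErrorRains.supportProj ρ).PosSemidef ∧
        r = ZeroErrorRains.opNorm (ZeroErrorRains.partialTranspose A B Q)}
      (ZeroErrorRains.gammaRains (ZeroErrorRains.supportProj ρ)) ∧
    -- multiplicativity under tensor powers
    (∀ n : ℕ,
      ZeroErrorRains.gammaRains (ZeroErrorRains.tensorPow (ZeroErrorRains.supportProj ρ) n) =
        ZeroErrorRains.gammaRains (ZeroErrorRains.supportProj ρ) ^ n) ∧
    -- the resulting bound for every class of PPT operations
    (∀ 𝒪 : ∀ n m : ℕ, Set (ZeroErrorRains.BMat (Fin n → A) (Fin n → B) →ₗ[ℂ]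
          ZeroErrorRains.BMat (Fin m) (Fin m)),
      (∀ n m, 𝒪 n m ⊆
        ZeroErrorRains.pptOperations (Fin n → A) (Fin n → B) (Fin m) (Fin m)) →
      ZeroErrorRains.asymptoticZeroError 𝒪 ρ ≤
        ((-Real.logb 2 (ZeroErrorRains.gammaRains (ZeroErrorRains.supportProj ρ)) : ℝ) :
          EReal)) := by
  have hS := ZeroErrorRains.posSemidef_supportProj ρ
  exact ⟨ZeroErrorRains.gammaRains_supportProj_pos hρ,
    ZeroErrorRains.asymptoticZeroError_rainsPreserving hρ,
    ZeroErrorRains.isLeast_gammaRains hS.isHermitian,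
    ZeroErrorRains.gammaRains_tensorPow hS,
    fun _ h => ZeroErrorRains.asymptoticZeroError_le_of_subset_pptOperations hρ h⟩
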